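/- Let $n\ge 3$ and $2\le k\le n$ be integers, and write $z=(x,y)\in\mathbb R^k\times\mathbb R^{n-k}=\mathbb R^n$. Let $p,s$ be real numbers with $1<p<n$, $0\le s<p$, $s<k$ and $s(n-k)<k(n-p)$. For $0\le t\le p$ put $$p^*(t)=\frac{p(n-t)}{n-p},\qquad p^*=p^*(0)=\frac{np}{n-p},\qquad r'=\frac{p^*}{p^*(s)-p}=\frac{n}{p-s}.$$ Let $\Omega\subseteq\mathbb R^n$ be open, not necessarily bounded, and let $\mathcal D^{1,p}(\Omega)$ be the closure of $C_c^\infty(\Omega)$ in the norm $\|\nabla u\|_{L^p}$, regarded, by the Sobolev inequality, as a space of functions in $L^{p^*}(\Omega)$ with weak gradient in $L^p(\Omega)$. Let $V\in L^{r'}(\Omega)$, and let $u\in\mathcal D^{1,p}(\Omega)$, $u\ge 0$ a.e., be a weak solution of $$-\operatorname{div}(|\nabla u|^{p-2}\nabla u)\le V\,\frac{|u|^{p-2}}{|x|^s}\,u\quad\text{in }\Omega,$$ i.e. $$\int_\Omega|\nabla u|^{p-2}\langle\nabla u,\nabla\phi\rangle\,dz\le\int_\Omega V\,\frac{|u|^{p-2}}{|x|^s}\,u\,\phi\,dz\qquad\text{for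 every }0\le\phi\in C_c^\infty(\Omega).$$ (a) Then $u\in L^q\bigl(\Omega,\frac{dz}{|x|^t}\bigr)$ for all real $t,q$ with $0\le t<\min\{p,k\}$ and $p^*(t)\le q<\infty$. In particular $u\in L^q(\Omega)$ for every $p^*\le q<\infty$. (b) If moreover $V\in L^{t_o}(\Omega)$ for some $t_o$ with $r'<t_o\le\infty$, then $u\in L^\infty(\Omega)$. -/

import Mathlib

open MeasureTheory Filter Topology
open scoped ENNReal ContDiff

namespace HardySobolev

/-- `ℝⁿ` with its Euclidean norm. -/
abbrev Space (n : ℕ) : Type := EuclideanSpace ℝ (Fin n)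

/-- For `z = (x, y) ∈ ℝᵏ × ℝⁿ⁻ᵏ = ℝⁿ` (`x` being the first `k` coordinates), the Euclidean norm `|x|`,
i.e. the distance of `z` to the subspace `{x = 0}`. -/
noncomputable def xNorm {n : ℕ} (k : ℕ) (z : Space n) : ℝ :=
  Real.sqrt (∑ i : Fin n with i.val < k, z i ^ 2)

/-- The Hardy-Sobolev conjugate `p*(s) = p (n - s) / (n - p)`; `p* = p*(0)` is the Sobolev conjugate. -/
noncomputable def pStar (n : ℕ) (p s : ℝ) : ℝ :=
  p * (n - s) / (n - p)

/-- The exponent `r' = p* / (p*(s) - p)` (used for `s < p`, where `p*(s) > p`). -/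
noncomputable def rPrime (n : ℕ) (p s : ℝ) : ℝ :=
  pStar n p 0 / (pStar n p s - p)

/-- The measure `dz / |x|^t` on `Ω`. -/
noncomputable def weighted {n : ℕ} (k : ℕ) (Ω : Set (Space n)) (t : ℝ) : Measure (Space n) :=
  (volume.restrict Ω).withDensity fun z => ENNReal.ofReal (xNorm k z ^ (-t))

/-- `φ ∈ C_c^∞(Ω)`. -/
structure IsTest {n : ℕ} (Ω : Set (Space n)) (φ : Space n → ℝ) : Prop where
  smooth : ContDiff ℝ ∞ φ
  compact : HasCompactSupport φ
  support : tsupport φ ⊆ Ω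

/-- `g` is the weak gradient of `u` on the open set `Ω`. -/
structure IsWeakGradient {n : ℕ} (Ω : Set (Space n)) (u : Space n → ℝ) (g : Space n → Space n) :
    Prop where
  locInt : LocallyIntegrableOn u Ω
  locInt_grad : LocallyIntegrableOn g Ω
  parts : ∀ φ : Space n → ℝ, IsTest Ω φ →
    ∫ z in Ω, u z • gradient φ z = - ∫ z in Ω, φ z • g z

/-- `u ∈ 𝒟^{1,p}(Ω)`, for `1 < p < n`: the closure of `C_c^∞(Ω)` in the norm `‖∇u‖_{L^p}`.
A sequence of test functions which is Cauchy in that norm converges in `L^{p*}`, by the Sobolev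
inequality, and its limit there is the function which the sequence represents. -/
def MemD {n : ℕ} (Ω : Set (Space n)) (p : ℝ) (u : Space n → ℝ) : Prop :=
  ∃ g : Space n → Space n, IsWeakGradient Ω u g ∧
    ∃ φ : ℕ → Space n → ℝ, (∀ j, IsTest Ω (φ j)) ∧
      Tendsto (fun j => eLpNorm (fun z => gradient (φ j) z - g z) (ENNReal.ofReal p)
        (volume.restrict Ω)) atTop (𝓝 0) ∧
      Tendsto (fun j => eLpNorm (fun z => φ j z - u z) (ENNReal.ofReal (pStar n p 0))
        (volume.restrict Ω)) atTop (𝓝 0)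

/-- `u` is a weak solution of `-div (|∇u|^{p-2} ∇u) ≤ V |u|^{p-2} u / |x|^s` in `Ω`. For
`u ∈ 𝒟^{1,p}(Ω)` and `V ∈ L^{r'}(Ω)` both integrands below are integrable, by the Hölder and
Hardy-Sobolev inequalities. -/
def IsWeakSubsolution {n : ℕ} (k : ℕ) (Ω : Set (Space n)) (p s : ℝ) (V u : Space n → ℝ) : Prop :=
  ∃ g : Space n → Space n, IsWeakGradient Ω u g ∧
    ∀ φ : Space n → ℝ, IsTest Ω φ → (∀ z, 0 ≤ φ z) →
      ∫ z in Ω, ‖g z‖ ^ (p - 2) * inner ℝ (g z) (gradient φ z) ≤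
        ∫ z in Ω, V z * (|u z| ^ (p - 2) / xNorm k z ^ s) * u z * φ z

end HardySobolev

/-!
# Integrability and boundedness of subsolutions with a cylindrical Hardy potential

The proof is Moser's iteration, driven by the Hardy-Sobolev inequality with weight `|x|^{-t}`,
`0 ≤ t < min p k`.

*The Hardy-Sobolev inequality* (`exists_hardySobolev`). The field `x (ε + |x|²)^{-t/2}` has divergence
at least `(k - t) (ε + |x|²)^{-t/2}`. Integrating by parts against `|u|^{p*(t)}` and applying Hölder's
inequality, for `1 ≤ t < min p k`, one gets `I ≤ C ‖∇u‖_p I^{1 - 1/t} I₀^{1/t - 1/p}`, where `I` is the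
regularized left hand side and `I₀ = ∫ |u|^{p*}`, which the Sobolev inequality controls. As `I` is
finite, it can be absorbed; then `ε → 0`. Smaller `t` follow by interpolation with `t = 0`, because
`p*` is an affine function. Since `k ≥ 2`, there is room for some `t ≥ 1`. The inequality passes to
`G(u)` for `u ∈ 𝒟^{1,p}(Ω)` and `G` of class `C¹` with bounded derivative.

*Test functions* (`IsSolution.weak_comp`). If `H ≥ 0` is bounded and continuous, vanishes on `(-∞, 0]`,
and has the primitive `F`, then `F(u)` is an admissible test function. For smooth `H` the functions
`F ∘ φⱼ` are nonnegative test functions if the test functions `φⱼ` approximate `u`; the right hand side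
converges by Hölder's inequality with the exponents `r'` and `r = n / (n - p + s)`, since
`p r = p*(s r)` and `s r < min p k`; the latter uses `s (n - k) < k (n - p)`. A continuous `H` is a
bounded pointwise limit of smooth ones.

*Energy* (`IsSolution.energy_truncPow_le`). Let `G` be the power `x^β`, `β > 1`, continued affinely
beyond `L`. The choice `H = (G')^p` gives `∫ |∇G(u)|^p ≤ β^p ∫ |V| G(u)^p |x|^{-s}`, because
`x G'(x) ≤ β G(x)`.

*All powers* (`IsSolution.lintegral_rpow_lt_top`). Write `|V| ≤ K + (|V| - K)⁺`. The second part has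
small norm in `L^{r'}`, and its contribution is absorbed; the first contributes at most
`K ∫ u^{β p} |x|^{-s}`. So if this integral is finite, then `u^β ∈ L^{p*(t)}(|x|^{-t})` for all `t`. As
`p*(s) > p`, the exponents `β = (p*(s)/p)^m` can be reached one after the other.

*Boundedness* (`IsSolution.memLp_top`). If `V ∈ L^a` with `r' < a < ∞`, and `d` is the exponent
conjugate to `a`, then `χ = p*(s d) / (p d) > 1`, and the energy estimate bounds the norm of `u` in
`L^{χ^{m+2} p d}(|x|^{-s d})` by the norm in `L^{χ^{m+1} p d}(|x|^{-s d})`, up to a factor which is a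
fixed power of `(D R^m)^{χ^{-m}}`. The product of these factors converges. As `{x = 0}` is a null set,
essential boundedness with respect to the weighted measure is the same as for Lebesgue measure.
-/

namespace HardySobolev

section

/-! ### The Hardy-Sobolev inequality for compactly supported functions of class `C¹` -/

/-- Hölder's inequality for a product of three functions. -/
theorem lintegral_rpow_mul_rpow_mul_rpow_le {α : Type*} [MeasurableSpace α] {μ : Measure α}
    {f g h : α → ℝ≥0∞} (hf : AEMeasurable f μ) (hg : AEMeasurable g μ) (hh : AEMeasurable h μ)
    {a b c : ℝ} (ha : 0 ≤ a) (hb : 0 ≤ b) (hc : 0 ≤ c) (habc : a + b + c = 1) :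
    ∫⁻ z, f z ^ a * g z ^ b * h z ^ c ∂μ ≤
      (∫⁻ z, f z ∂μ) ^ a * (∫⁻ z, g z ∂μ) ^ b * (∫⁻ z, h z ∂μ) ^ c := by
  have := ENNReal.lintegral_prod_norm_pow_le (μ := μ) (Finset.univ : Finset (Fin 3))
    (f := ![f, g, h]) (p := ![a, b, c]) (by simp [Fin.forall_fin_succ, hf, hg, hh])
    (by simp [Fin.sum_univ_succ]; linarith) (by simp [Fin.forall_fin_succ, ha, hb, hc])
  simpa [Fin.prod_univ_succ, mul_assoc] using this

variable {n : ℕ}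

/-- The square `ε + |x|²` of the regularized distance to `{x = 0}`. -/
noncomputable def regSq (k : ℕ) (ε : ℝ) (z : Space n) : ℝ :=
  ε + ∑ i : Fin n with i.val < k, z i ^ 2

theorem xNorm_nonneg (k : ℕ) (z : Space n) : 0 ≤ xNorm k z := Real.sqrt_nonneg _

theorem xNorm_sq (k : ℕ) (z : Space n) :
    xNorm k z ^ 2 = ∑ i : Fin n with i.val < k, z i ^ 2 :=
  Real.sq_sqrt (Finset.sum_nonneg fun _ _ => sq_nonneg _)

theorem regSq_eq (k : ℕ) (ε : ℝ) (z : Space n) : regSq k ε z = ε + xNorm k z ^ 2 := by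
  rw [xNorm_sq, regSq]

theorem regSq_pos {k : ℕ} {ε : ℝ} (hε : 0 < ε) (z : Space n) : 0 < regSq k ε z := by
  rw [regSq_eq]; positivity

theorem continuous_xNorm (k : ℕ) : Continuous (xNorm k : Space n → ℝ) := by
  unfold xNorm; fun_prop

theorem continuous_regSq (k : ℕ) (ε : ℝ) : Continuous (regSq k ε : Space n → ℝ) := by
  unfold regSq; fun_prop

theorem continuous_regSq_rpow (k : ℕ) {ε : ℝ} (hε : 0 < ε) (a : ℝ) :
    Continuous fun z : Space n => regSq k ε z ^ a :=
  (continuous_regSq k ε).rpow_const fun z => Or.inl (regSq_pos hε z).ne'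

theorem measurable_xNorm (k : ℕ) : Measurable (xNorm k : Space n → ℝ) :=
  (continuous_xNorm k).measurable

theorem hasFDerivAt_regSq (k : ℕ) (ε : ℝ) (z : Space n) :
    HasFDerivAt (regSq k ε)
      (∑ i : Fin n with i.val < k, (2 * z i) • (EuclideanSpace.proj i : Space n →L[ℝ] ℝ)) z := by
  unfold regSq
  refine HasFDerivAt.const_add _ (HasFDerivAt.fun_sum fun i _ => ?_)
  have := ((EuclideanSpace.proj i : Space n →L[ℝ] ℝ).hasFDerivAt (x := z)).pow 2
  simpa using this

theorem norm_sum_smul_single (k : ℕ) (z : Space n) :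
    ‖∑ i : Fin n with i.val < k, z i • EuclideanSpace.single i (1 : ℝ)‖ = xNorm k z := by
  rw [EuclideanSpace.norm_eq, xNorm]
  congr 1
  conv_rhs => rw [Finset.sum_filter]
  refine Finset.sum_congr rfl fun j _ => ?_
  rw [WithLp.ofLp_sum, Finset.sum_apply]
  simp only [PiLp.smul_apply, PiLp.single_apply, smul_eq_mul, mul_ite, mul_one, mul_zero,
    Finset.sum_ite_eq, Finset.mem_filter, Finset.mem_univ, true_and]
  split_ifs <;> simp

/-- The regularized Hardy inequality in `L¹`: the field `x (ε + |x|²)^{-t/2}` has divergence at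
least `(k - t) (ε + |x|²)^{-t/2}`. -/
theorem integral_mul_regSq_rpow_le {k : ℕ} (hkn : k ≤ n) {ε t : ℝ} (hε : 0 < ε) (ht : 0 ≤ t)
    {f : Space n → ℝ} (hf : ContDiff ℝ 1 f) (hfc : HasCompactSupport f) (hf0 : ∀ z, 0 ≤ f z) :
    (k - t) * ∫ z, f z * regSq k ε z ^ (-t / 2) ≤
      ∫ z, ‖fderiv ℝ f z‖ * regSq k ε z ^ ((1 - t) / 2) := by
  set S : Finset (Fin n) := Finset.univ.filter fun i => i.val < k with hS
  set e : Fin n → Space n := fun i => EuclideanSpace.single i (1 : ℝ) with he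
  have hcard : (S.card : ℝ) = k := by
    rw [hS, Fin.card_filter_val_lt]; simp [hkn]
  set g : Fin n → Space n → ℝ := fun i z => z i * regSq k ε z ^ (-t / 2) with hg
  have hder (i : Fin n) (hi : i ∈ S) (z : Space n) : HasFDerivAt (g i)
      (z i • ((-t / 2 * regSq k ε z ^ (-t / 2 - 1)) •
        (∑ i : Fin n with i.val < k, (2 * z i) • (EuclideanSpace.proj i : Space n →L[ℝ] ℝ))) +
        regSq k ε z ^ (-t / 2) • (EuclideanSpace.proj i : Space n →L[ℝ] ℝ)) z := by
    have h1 := (hasFDerivAt_regSq k ε z).rpow_const (p := -t / 2) (Or.inl (regSq_pos hε z).ne')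
    exact ((EuclideanSpace.proj i : Space n →L[ℝ] ℝ).hasFDerivAt (x := z)).mul h1
  have hder' (i : Fin n) (hi : i ∈ S) (z : Space n) : fderiv ℝ (g i) z (e i) =
      regSq k ε z ^ (-t / 2) - t * z i ^ 2 * regSq k ε z ^ (-t / 2 - 1) := by
    have hi' : i.val < k := by simpa [hS] using hi
    rw [(hder i hi z).fderiv]
    simp [he, hi']
    ring
  have hgc (i : Fin n) : Continuous (g i) :=
    (EuclideanSpace.proj i : Space n →L[ℝ] ℝ).continuous.mul
      (continuous_regSq_rpow k hε _)
  have hfd : Continuous (fderiv ℝ f) := hf.continuous_fderiv (by norm_num)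
  have hfdc : HasCompactSupport (fderiv ℝ f) := hfc.fderiv ℝ
  have hrc := fun a => continuous_regSq_rpow (n := n) k hε a
  have hint1 (i : Fin n) : Integrable (fun z => fderiv ℝ f z (e i) * g i z) := by
    refine Continuous.integrable_of_hasCompactSupport ((hfd.clm_apply continuous_const).mul (hgc i))
      ?_
    exact HasCompactSupport.mul_right (f := fun z => fderiv ℝ f z (e i))
      (hfdc.comp_left (g := fun L : Space n →L[ℝ] ℝ => L (e i)) (by simp))
  have hint2 (i : Fin n) (hi : i ∈ S) : Integrable (fun z => f z * fderiv ℝ (g i) z (e i)) := by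
    simp_rw [hder' i hi]
    refine Continuous.integrable_of_hasCompactSupport (hf.continuous.mul ((hrc _).sub
      ((continuous_const.mul (Continuous.pow ?_ 2)).mul (hrc _)))) hfc.mul_right
    exact (EuclideanSpace.proj i : Space n →L[ℝ] ℝ).continuous
  have hparts (i : Fin n) (hi : i ∈ S) : ∫ z, f z * fderiv ℝ (g i) z (e i) =
      - ∫ z, fderiv ℝ f z (e i) * g i z :=
    integral_mul_fderiv_eq_neg_fderiv_mul_of_integrable (hint1 i) (hint2 i hi)
      ((hf.continuous.mul (hgc i)).integrable_of_hasCompactSupport hfc.mul_right)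
      (fun z _ => hf.differentiable (by norm_num) z)
      (fun z _ => (hder i hi z).differentiableAt)
  calc (k - t) * ∫ z, f z * regSq k ε z ^ (-t / 2)
      ≤ ∫ z, ∑ i ∈ S, f z * fderiv ℝ (g i) z (e i) := by
        rw [← integral_const_mul]
        refine integral_mono ?_ (integrable_finsetSum _ hint2) fun z => ?_
        · exact ((hf.continuous.mul (hrc _)).integrable_of_hasCompactSupport
            hfc.mul_right).const_mul _
        · have h1 : ∑ i ∈ S, f z * fderiv ℝ (g i) z (e i) =
              f z * (k * regSq k ε z ^ (-t / 2) -
                t * xNorm k z ^ 2 * regSq k ε z ^ (-t / 2 - 1)) := by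
            rw [← Finset.mul_sum, Finset.sum_congr rfl fun i hi => hder' i hi z,
              Finset.sum_sub_distrib, ← Finset.sum_mul, ← Finset.mul_sum, xNorm_sq,
              Finset.sum_const, nsmul_eq_mul, hcard]
          have hp := regSq_pos (k := k) hε z
          have h2 : xNorm k z ^ 2 * regSq k ε z ^ (-t / 2 - 1) ≤ regSq k ε z ^ (-t / 2) := by
            rw [Real.rpow_sub_one hp.ne', ← mul_div_assoc, div_le_iff₀ hp, mul_comm]
            gcongr
            rw [regSq_eq]; linarith
          show (k - t) * (f z * regSq k ε z ^ (-t / 2)) ≤ _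
          rw [h1]
          have := mul_le_mul_of_nonneg_left (mul_le_mul_of_nonneg_left h2 ht) (hf0 z)
          linarith
    _ = ∫ z, - ∑ i ∈ S, fderiv ℝ f z (e i) * g i z := by
        rw [integral_finsetSum _ hint2, integral_neg, integral_finsetSum _ fun i _ => hint1 i,
          ← Finset.sum_neg_distrib]
        exact Finset.sum_congr rfl hparts
    _ ≤ ∫ z, ‖fderiv ℝ f z‖ * regSq k ε z ^ ((1 - t) / 2) := by
        refine integral_mono (integrable_finsetSum _ fun i _ => hint1 i).neg
          ((hfd.norm.mul (hrc _)).integrable_of_hasCompactSupport hfdc.norm.mul_right) fun z => ?_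
        have hp := regSq_pos (k := k) hε z
        have h1 : ∑ i ∈ S, fderiv ℝ f z (e i) * g i z =
            fderiv ℝ f z (∑ i ∈ S, z i • e i) * regSq k ε z ^ (-t / 2) := by
          rw [map_sum, Finset.sum_mul]
          refine Finset.sum_congr rfl fun i _ => ?_
          simp [hg]; ring
        show - ∑ i ∈ S, fderiv ℝ f z (e i) * g i z ≤ _
        rw [h1, ← neg_mul]
        have h2 : -(fderiv ℝ f z (∑ i ∈ S, z i • e i)) ≤ ‖fderiv ℝ f z‖ * xNorm k z := by
          rw [← norm_sum_smul_single]
          exact (neg_le_abs _).trans ((fderiv ℝ f z).le_opNorm _)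
        have h3 : xNorm k z ≤ regSq k ε z ^ (1 / 2 : ℝ) := by
          rw [← Real.sqrt_eq_rpow]
          apply Real.le_sqrt_of_sq_le
          rw [regSq_eq]; linarith
        calc _ ≤ (‖fderiv ℝ f z‖ * regSq k ε z ^ (1 / 2 : ℝ)) * regSq k ε z ^ (-t / 2) := by
              gcongr
              exact h2.trans (by gcongr)
          _ = _ := by
              rw [mul_assoc, ← Real.rpow_add hp]; congr 2; ring

end

section

variable {n : ℕ}

/-- The regularized Hardy inequality for `|u|^q`. -/
theorem lintegral_norm_rpow_mul_regSq_rpow_le {k : ℕ} (hkn : k ≤ n) {ε t q : ℝ} (hε : 0 < ε)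
    (ht : 0 ≤ t) (htk : t < k) (hq : 1 < q)
    {u : Space n → ℝ} (hu : ContDiff ℝ 1 u) (huc : HasCompactSupport u) :
    ∫⁻ z, ‖u z‖ₑ ^ q * ENNReal.ofReal (regSq k ε z ^ (-t / 2)) ≤ ENNReal.ofReal (q / (k - t)) *
      ∫⁻ z, ‖fderiv ℝ u z‖ₑ * ‖u z‖ₑ ^ (q - 1) * ENNReal.ofReal (regSq k ε z ^ ((1 - t) / 2)) := by
  have hkt : 0 < k - t := by linarith
  have hf : ContDiff ℝ 1 fun z => ‖u z‖ ^ q := hu.norm_rpow hq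
  have hfc : HasCompactSupport fun z => ‖u z‖ ^ q :=
    huc.comp_left (g := fun x : ℝ => ‖x‖ ^ q) (by simp [Real.zero_rpow (by linarith : q ≠ 0)])
  have hfd : Continuous (fderiv ℝ fun z => ‖u z‖ ^ q) := hf.continuous_fderiv (by norm_num)
  have hrc := fun a => continuous_regSq_rpow (n := n) k hε a
  have hr0 (a : ℝ) (z : Space n) : 0 ≤ regSq k ε z ^ a := (Real.rpow_pos_of_pos (regSq_pos hε z) a).le
  have key := integral_mul_regSq_rpow_le hkn hε ht hf hfc fun z => by positivity
  rw [← le_div_iff₀' hkt] at key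
  have e1 : ∫⁻ z, ‖u z‖ₑ ^ q * ENNReal.ofReal (regSq k ε z ^ (-t / 2)) =
      ENNReal.ofReal (∫ z, ‖u z‖ ^ q * regSq k ε z ^ (-t / 2)) := by
    rw [ofReal_integral_eq_lintegral_ofReal (f := fun z => ‖u z‖ ^ q * regSq k ε z ^ (-t / 2))
      ((hf.continuous.mul (hrc _)).integrable_of_hasCompactSupport hfc.mul_right)
      (ae_of_all _ fun z => mul_nonneg (by positivity) (hr0 _ z))]
    refine lintegral_congr fun z => ?_
    rw [ENNReal.ofReal_mul (by positivity), ← ENNReal.ofReal_rpow_of_nonneg (norm_nonneg _)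
      (by linarith), ofReal_norm]
  rw [e1]
  refine (ENNReal.ofReal_le_ofReal key).trans ?_
  rw [div_eq_mul_inv, mul_comm, ENNReal.ofReal_mul (by positivity), ofReal_integral_eq_lintegral_ofReal
      (f := fun z => ‖fderiv ℝ (fun z => ‖u z‖ ^ q) z‖ * regSq k ε z ^ ((1 - t) / 2))
      ((hfd.norm.mul (hrc _)).integrable_of_hasCompactSupport (hfc.fderiv ℝ).norm.mul_right)
      (ae_of_all _ fun z => mul_nonneg (norm_nonneg _) (hr0 _ z)),
    div_eq_inv_mul q, ENNReal.ofReal_mul (by positivity), mul_assoc,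
    ← lintegral_const_mul' (ENNReal.ofReal q) _ ENNReal.ofReal_ne_top]
  refine mul_le_mul_right (lintegral_mono fun z => ?_) _
  rw [ENNReal.ofReal_mul (norm_nonneg _), ← mul_assoc]
  gcongr
  refine (ENNReal.ofReal_le_ofReal (norm_fderiv_norm_rpow_le
    (hu.differentiable (by norm_num)) hq)).trans_eq ?_
  rw [ENNReal.ofReal_mul (by positivity), ENNReal.ofReal_mul (by positivity),
    ← ENNReal.ofReal_rpow_of_nonneg (norm_nonneg _) (by linarith), ofReal_norm,
    ofReal_norm]
  ring

/-- Absorption of a power of a finite quantity. -/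
theorem le_rpow_of_le_mul_rpow {I K : ℝ≥0∞} {t : ℝ} (ht : 1 ≤ t) (hI : I ≠ ⊤)
    (h : I ≤ K * I ^ (1 - 1 / t)) : I ≤ K ^ t := by
  have ht0 : 0 < t := by linarith
  rcases eq_or_ne I 0 with rfl | hI0
  · simp
  have h1 : I ^ (1 - 1 / t) ≠ 0 := (ENNReal.rpow_pos (pos_iff_ne_zero.2 hI0) hI).ne'
  have h2 : I ^ (1 - 1 / t) ≠ ⊤ :=
    ENNReal.rpow_ne_top_of_nonneg (sub_nonneg.2 ((div_le_one ht0).2 ht)) hI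
  have h3 : I ^ (1 / t) ≤ K := by
    have : I ^ (1 / t) * I ^ (1 - 1 / t) ≤ K * I ^ (1 - 1 / t) := by
      rw [← ENNReal.rpow_add _ _ hI0 hI]; simpa using h
    exact (ENNReal.mul_le_mul_iff_left h1 h2).1 this
  calc I = (I ^ (1 / t)) ^ t := by
        rw [← ENNReal.rpow_mul, one_div_mul_cancel ht0.ne', ENNReal.rpow_one]
    _ ≤ K ^ t := by gcongr

theorem pStar_pos {p t : ℝ} (hp : 0 < p) (hpn : p < n) (htp : t ≤ p) : 0 < pStar n p t := by
  unfold pStar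
  exact div_pos (mul_pos hp (by linarith)) (by linarith)

/-- The Sobolev inequality, in terms of integrals. -/
theorem exists_sobolev {p : ℝ} (hp : 1 ≤ p) (hpn : p < n) :
    ∃ C : ℝ≥0∞, C ≠ ⊤ ∧ ∀ u : Space n → ℝ, ContDiff ℝ 1 u → HasCompactSupport u →
      ∫⁻ z, ‖u z‖ₑ ^ pStar n p 0 ≤
        C * (∫⁻ z, ‖fderiv ℝ u z‖ₑ ^ p) ^ ((n : ℝ) / (n - p)) := by
  have hp0 : 0 < p := by linarith
  have hnp : 0 < n - p := by linarith
  have hn0 : (0 : ℝ) < n := by linarith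
  have hq0 : 0 < pStar n p 0 := pStar_pos hp0 hpn hp0.le
  lift p to NNReal using hp0.le
  set q : NNReal := ⟨pStar n p 0, hq0.le⟩ with hq
  have hq1 : q ≠ 0 := fun h => hq0.ne' (congrArg NNReal.toReal h)
  refine ⟨(SNormLESNormFDerivOfEqConst ℝ (volume : Measure (Space n)) p : ℝ≥0∞) ^ pStar n p 0,
    ENNReal.rpow_ne_top_of_nonneg hq0.le ENNReal.coe_ne_top, fun u hu huc => ?_⟩
  have h := eLpNorm_le_eLpNorm_fderiv_of_eq (volume : Measure (Space n)) hu huc (p := p) (p' := q)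
    (by exact_mod_cast hp) (by simp; exact_mod_cast hn0) (by
      show (pStar n p 0)⁻¹ = _
      simp only [finrank_euclideanSpace, Fintype.card_fin, pStar, sub_zero, inv_div, NNReal.coe_inv]
      field_simp)
  rw [eLpNorm_eq_lintegral_rpow_enorm_toReal (by simpa using hq1) (by simp),
    eLpNorm_eq_lintegral_rpow_enorm_toReal (by simpa using hp0.ne') (by simp)] at h
  have h2 := ENNReal.rpow_le_rpow h hq0.le
  rw [ENNReal.mul_rpow_of_nonneg _ _ hq0.le, ← ENNReal.rpow_mul, ← ENNReal.rpow_mul] at h2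
  simp only [ENNReal.coe_toReal] at h2
  have hqc : (q : ℝ) = pStar n p 0 := rfl
  rw [hqc, one_div_mul_cancel hq0.ne', ENNReal.rpow_one] at h2
  refine h2.trans_eq ?_
  congr 2
  simp only [pStar, sub_zero]; field_simp


theorem continuous_ofReal_regSq_rpow (k : ℕ) {ε : ℝ} (hε : 0 < ε) (a : ℝ) :
    Continuous fun z : Space n => ENNReal.ofReal (regSq k ε z ^ a) :=
  ENNReal.continuous_ofReal.comp (continuous_regSq_rpow k hε a)

theorem ofReal_regSq_rpow_rpow {k : ℕ} {ε : ℝ} (hε : 0 < ε) (a b : ℝ) (z : Space n) :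
    ENNReal.ofReal (regSq k ε z ^ a) ^ b = ENNReal.ofReal (regSq k ε z ^ (a * b)) := by
  have h := regSq_pos (k := k) hε z
  rw [ENNReal.ofReal_rpow_of_pos (Real.rpow_pos_of_pos h _), Real.rpow_mul h.le]

theorem pStar_gt_self {p t : ℝ} (hp : 0 < p) (hpn : p < n) (htp : t < p) : p < pStar n p t := by
  rw [pStar, lt_div_iff₀ (by linarith)]
  nlinarith

/-- The Hardy-Sobolev inequality with the regularized weight `(ε + |x|²)^{-t/2}`, with a constant
independent of `ε`. The left hand side `I` is finite and, by the Hardy inequality for `|u|^{p*(t)}`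
and Hölder's inequality, at most `C ‖∇u‖_p I^{1 - 1/t} I₀^{1/t - 1/p}`, where `I₀ = ∫ |u|^{p*}`. -/
theorem exists_hardySobolev_regSq {k : ℕ} (hkn : k ≤ n) {p t : ℝ} (hp : 1 < p) (hpn : p < n)
    (ht : 1 ≤ t) (htk : t < k) (htp : t < p) :
    ∃ C : ℝ≥0∞, C ≠ ⊤ ∧ ∀ ε : ℝ, 0 < ε → ∀ u : Space n → ℝ, ContDiff ℝ 1 u → HasCompactSupport u →
      ∫⁻ z, ‖u z‖ₑ ^ pStar n p t * ENNReal.ofReal (regSq k ε z ^ (-t / 2)) ≤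
        C * (∫⁻ z, ‖fderiv ℝ u z‖ₑ ^ p) ^ ((n - t) / (n - p)) := by
  have hp0 : 0 < p := by linarith
  have hnp : 0 < n - p := by linarith
  have ht0 : 0 < t := by linarith
  set q := pStar n p t with hq
  have hpq : p < q := pStar_gt_self hp0 hpn htp
  have hq1 : 1 < q := hp.trans hpq
  obtain ⟨S, hS, hsob⟩ := exists_sobolev (n := n) hp.le hpn
  set K : ℝ≥0∞ := ENNReal.ofReal (q / (k - t)) with hK
  have h1t : 0 ≤ 1 - 1 / t := sub_nonneg.2 ((div_le_one ht0).2 ht)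
  have hb : 0 ≤ 1 / t - 1 / p := sub_nonneg.2 (one_div_le_one_div_of_le ht0 htp.le)
  refine ⟨K ^ t * S ^ ((1 / t - 1 / p) * t), ENNReal.mul_ne_top
    (ENNReal.rpow_ne_top_of_nonneg ht0.le ENNReal.ofReal_ne_top)
    (ENNReal.rpow_ne_top_of_nonneg (by positivity) hS), fun ε hε u hu huc => ?_⟩
  have hud : Continuous (fderiv ℝ u) := hu.continuous_fderiv (by norm_num)
  have hwc := fun a => continuous_ofReal_regSq_rpow (n := n) k hε a
  set w : Space n → ℝ≥0∞ := fun z => ENNReal.ofReal (regSq k ε z ^ (-t / 2)) with hwdef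
  set I := ∫⁻ z, ‖u z‖ₑ ^ q * w z with hI
  set D := ∫⁻ z, ‖fderiv ℝ u z‖ₑ ^ p with hD
  have hum : AEMeasurable (fun z => ‖u z‖ₑ) (volume : Measure (Space n)) :=
    hu.continuous.measurable.enorm.aemeasurable
  have hIfin : I ≠ ⊤ := by
    have hint : Integrable fun z => ‖u z‖ ^ q * regSq k ε z ^ (-t / 2) := by
      refine Continuous.integrable_of_hasCompactSupport ((hu.continuous.norm.rpow_const
        fun _ => Or.inr (by linarith)).mul (continuous_regSq_rpow k hε _)) (HasCompactSupport.mul_right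
          (huc.comp_left (g := fun x : ℝ => ‖x‖ ^ q) ?_))
      simp [Real.zero_rpow (by linarith : q ≠ 0)]
    have := hint.lintegral_lt_top
    refine ne_of_lt (lt_of_eq_of_lt ?_ this)
    refine lintegral_congr fun z => ?_
    rw [ENNReal.ofReal_mul (by positivity), ← ENNReal.ofReal_rpow_of_nonneg (norm_nonneg _)
      (by linarith), ofReal_norm]
  have h1 := lintegral_norm_rpow_mul_regSq_rpow_le hkn hε ht0.le htk hq1 hu huc
  have h2 : ∫⁻ z, ‖fderiv ℝ u z‖ₑ * ‖u z‖ₑ ^ (q - 1) * ENNReal.ofReal (regSq k ε z ^ ((1 - t) / 2))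
      ≤ D ^ (1 / p) * I ^ (1 - 1 / t) * (∫⁻ z, ‖u z‖ₑ ^ pStar n p 0) ^ (1 / t - 1 / p) := by
    refine le_trans (lintegral_mono fun z => le_of_eq ?_)
      (lintegral_rpow_mul_rpow_mul_rpow_le (g := fun z => ‖u z‖ₑ ^ q * w z)
      (hud.measurable.enorm.pow_const p).aemeasurable
      ((hum.pow_const q).mul (hwc _).measurable.aemeasurable) (hum.pow_const (pStar n p 0))
      (by positivity) h1t hb (by ring))
    have e1 : q * (1 - 1 / t) + pStar n p 0 * (1 / t - 1 / p) = q - 1 := by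
      rw [hq, pStar, pStar]; field_simp; ring
    have e2 : -t / 2 * (1 - 1 / t) = (1 - t) / 2 := by field_simp; ring
    have e3 : ‖u z‖ₑ ^ (q * (1 - 1 / t)) * ‖u z‖ₑ ^ (pStar n p 0 * (1 / t - 1 / p)) =
        ‖u z‖ₑ ^ (q - 1) := by
      rw [← ENNReal.rpow_add_of_nonneg _ _ (by positivity)
        (mul_nonneg (pStar_pos hp0 hpn hp0.le).le hb), e1]
    rw [← ENNReal.rpow_mul, mul_one_div_cancel hp0.ne', ENNReal.rpow_one,
      ENNReal.mul_rpow_of_nonneg _ _ h1t, ← ENNReal.rpow_mul, ← ENNReal.rpow_mul, hwdef]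
    simp only
    rw [ofReal_regSq_rpow_rpow hε, e2, ← e3]
    ring
  have h3 : I ≤ (K * D ^ (1 / p) * (S * D ^ ((n : ℝ) / (n - p))) ^ (1 / t - 1 / p)) *
      I ^ (1 - 1 / t) := by
    refine h1.trans ((mul_le_mul_right h2 _).trans ?_)
    calc _ ≤ K * (D ^ (1 / p) * I ^ (1 - 1 / t) *
          (S * D ^ ((n : ℝ) / (n - p))) ^ (1 / t - 1 / p)) := by
          gcongr
          exact hsob u hu huc
      _ = _ := by ring
  refine (le_rpow_of_le_mul_rpow ht hIfin h3).trans_eq ?_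
  rw [ENNReal.mul_rpow_of_nonneg _ _ hb, ENNReal.mul_rpow_of_nonneg _ _ ht0.le,
    ENNReal.mul_rpow_of_nonneg _ _ ht0.le, ENNReal.mul_rpow_of_nonneg _ _ ht0.le,
    ← ENNReal.rpow_mul, ← ENNReal.rpow_mul, ← ENNReal.rpow_mul, ← ENNReal.rpow_mul]
  have e4 : (n - t) / (n - p) = 1 / p * t + (n : ℝ) / (n - p) * ((1 / t - 1 / p) * t) := by
    field_simp; ring
  rw [e4, ENNReal.rpow_add_of_nonneg _ _ (by positivity)
    (mul_nonneg (by positivity) (mul_nonneg hb ht0.le))]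
  ring

/-- The weight `|x|^{-t}`, with the value `0` on `{x = 0}` for `t ≠ 0`. -/
noncomputable def weight (k : ℕ) (t : ℝ) (z : Space n) : ℝ≥0∞ := ENNReal.ofReal (xNorm k z ^ (-t))

theorem measurable_weight (k : ℕ) (t : ℝ) : Measurable (weight k t : Space n → ℝ≥0∞) :=
  ((measurable_xNorm k).pow_const _).ennreal_ofReal

theorem weight_ne_top (k : ℕ) (t : ℝ) (z : Space n) : weight k t z ≠ ⊤ := ENNReal.ofReal_ne_top

theorem weight_mul (k : ℕ) (t : ℝ) {a : ℝ} (ha : 0 ≤ a) (z : Space n) :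
    weight k (t * a) z = weight k t z ^ a := by
  rw [weight, weight, ENNReal.ofReal_rpow_of_nonneg (Real.rpow_nonneg (xNorm_nonneg k z) _) ha,
    ← Real.rpow_mul (xNorm_nonneg k z), neg_mul]

/-- At `x = 0` the inequality holds because the weight has the junk value `0` there. -/
theorem weight_le_liminf (k : ℕ) {t : ℝ} (ht : 0 < t) (z : Space n) :
    weight k t z ≤ liminf (fun j : ℕ =>
      ENNReal.ofReal (regSq k (1 / ((j : ℝ) + 1)) z ^ (-t / 2))) atTop := by
  rcases (xNorm_nonneg k z).eq_or_lt with h | h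
  · rw [weight, ← h, Real.zero_rpow (by linarith)]; simp
  · refine le_of_eq (Tendsto.liminf_eq ?_).symm
    refine (ENNReal.continuous_ofReal.tendsto _).comp ?_
    have h1 : Tendsto (fun j : ℕ => regSq k (1 / ((j : ℝ) + 1)) z) atTop (𝓝 (xNorm k z ^ 2)) := by
      simp_rw [regSq_eq]
      simpa using tendsto_one_div_add_atTop_nhds_zero_nat.add_const (xNorm k z ^ 2)
    have h2 := h1.rpow_const (p := -t / 2) (Or.inl (by positivity))
    rwa [← Real.rpow_natCast_mul h.le, show ((2 : ℕ) : ℝ) * (-t / 2) = -t by push_cast; ring] at h2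

/-- The Hardy-Sobolev inequality for compactly supported functions of class `C¹`. -/
theorem exists_hardySobolev {k : ℕ} (hk : 1 < k) (hkn : k ≤ n) {p t : ℝ} (hp : 1 < p) (hpn : p < n)
    (ht : 0 ≤ t) (htk : t < min p k) :
    ∃ C : ℝ≥0∞, C ≠ ⊤ ∧ ∀ u : Space n → ℝ, ContDiff ℝ 1 u → HasCompactSupport u →
      ∫⁻ z, ‖u z‖ₑ ^ pStar n p t * weight k t z ≤
        C * (∫⁻ z, ‖fderiv ℝ u z‖ₑ ^ p) ^ ((n - t) / (n - p)) := by
  have hp0 : 0 < p := by linarith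
  have hnp : 0 < n - p := by linarith
  have hm : 1 < min p (k : ℝ) := lt_min hp (by exact_mod_cast hk)
  -- the inequality is known for some exponent `a ≥ max 1 t`, and it is interpolated with the
  -- Sobolev inequality below `a`
  obtain ⟨a, ha, ham⟩ := exists_between (max_lt hm htk)
  have ha1 : 1 < a := (le_max_left _ _).trans_lt ha
  have hta : t < a := (le_max_right _ _).trans_lt ha
  have ha0 : 0 < a := by linarith
  obtain ⟨C, hC, hCu⟩ := exists_hardySobolev_regSq hkn hp hpn ha1.le (ham.trans_le (min_le_right _ _))
    (ham.trans_le (min_le_left _ _))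
  obtain ⟨S, hS, hsob⟩ := exists_sobolev (n := n) hp.le hpn
  have hap : a < p := ham.trans_le (min_le_left _ _)
  have hta1 : 0 ≤ 1 - t / a := sub_nonneg.2 ((div_le_one ha0).2 hta.le)
  refine ⟨C ^ (t / a) * S ^ (1 - t / a), ENNReal.mul_ne_top
    (ENNReal.rpow_ne_top_of_nonneg (by positivity) hC)
    (ENNReal.rpow_ne_top_of_nonneg hta1 hS), fun u hu huc => ?_⟩
  set D := ∫⁻ z, ‖fderiv ℝ u z‖ₑ ^ p with hD
  have hum : Measurable (fun z => ‖u z‖ₑ) := hu.continuous.measurable.enorm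
  have h1 : ∫⁻ z, ‖u z‖ₑ ^ pStar n p a * weight k a z ≤ C * D ^ ((n - a) / (n - p)) := by
    calc ∫⁻ z, ‖u z‖ₑ ^ pStar n p a * weight k a z
        ≤ ∫⁻ z, liminf (fun j : ℕ => ‖u z‖ₑ ^ pStar n p a *
          ENNReal.ofReal (regSq k (1 / ((j : ℝ) + 1)) z ^ (-a / 2))) atTop := by
          refine lintegral_mono fun z => ?_
          rw [ENNReal.liminf_const_mul_of_ne_top (ENNReal.rpow_ne_top_of_nonneg
            (pStar_pos hp0 hpn hap.le).le enorm_ne_top)]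
          gcongr
          exact weight_le_liminf k ha0 z
      _ ≤ liminf (fun j : ℕ => ∫⁻ z, ‖u z‖ₑ ^ pStar n p a *
          ENNReal.ofReal (regSq k (1 / ((j : ℝ) + 1)) z ^ (-a / 2))) atTop :=
          lintegral_liminf_le fun j => (hum.pow_const _).mul
            (continuous_ofReal_regSq_rpow k (by positivity) _).measurable
      _ ≤ C * D ^ ((n - a) / (n - p)) :=
          liminf_le_of_le (by isBoundedDefault) fun b hb => by
            obtain ⟨j, hj⟩ := hb.exists
            exact hj.trans (hCu _ (by positivity) u hu huc)
  have h2 : ∫⁻ z, ‖u z‖ₑ ^ pStar n p t * weight k t z ≤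
      (∫⁻ z, ‖u z‖ₑ ^ pStar n p a * weight k a z) ^ (t / a) *
        (∫⁻ z, ‖u z‖ₑ ^ pStar n p 0) ^ (1 - t / a) := by
    refine le_trans (lintegral_mono fun z => le_of_eq ?_) (ENNReal.lintegral_mul_norm_pow_le
      (f := fun z => ‖u z‖ₑ ^ pStar n p a * weight k a z)
      ((hum.pow_const _).mul (measurable_weight k a)).aemeasurable (hum.pow_const _).aemeasurable
      (by positivity) hta1 (by ring))
    rw [ENNReal.mul_rpow_of_nonneg _ _ (by positivity), ← weight_mul k a (by positivity),
      mul_div_cancel₀ _ ha0.ne', ← ENNReal.rpow_mul, ← ENNReal.rpow_mul, mul_right_comm,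
      ← ENNReal.rpow_add_of_nonneg _ _ (mul_nonneg (pStar_pos hp0 hpn hap.le).le (by positivity))
        (mul_nonneg (pStar_pos hp0 hpn hp0.le).le hta1)]
    congr 2
    rw [pStar, pStar, pStar]; field_simp; ring
  calc _ ≤ (C * D ^ ((n - a) / (n - p))) ^ (t / a) * (S * D ^ ((n : ℝ) / (n - p))) ^ (1 - t / a) := by
        refine h2.trans ?_
        gcongr
        exact hsob u hu huc
    _ = C ^ (t / a) * S ^ (1 - t / a) * (D ^ ((n - a) / (n - p) * (t / a)) *
          D ^ ((n : ℝ) / (n - p) * (1 - t / a))) := by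
        rw [ENNReal.mul_rpow_of_nonneg _ _ (by positivity), ENNReal.mul_rpow_of_nonneg _ _ hta1,
          ← ENNReal.rpow_mul, ← ENNReal.rpow_mul]
        ring
    _ = _ := by
        have : 0 < n - a := by linarith
        rw [← ENNReal.rpow_add_of_nonneg _ _ (by positivity) (mul_nonneg (by positivity) hta1)]
        congr 2
        field_simp; ring

end

section

variable {n : ℕ}

/-! ### Test functions and their limits -/

theorem eLpNorm_ofReal {α E : Type*} [MeasurableSpace α] {μ : Measure α} [NormedAddCommGroup E]
    {p : ℝ} (hp : 0 < p) (f : α → E) :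
    eLpNorm f (ENNReal.ofReal p) μ = (∫⁻ z, ‖f z‖ₑ ^ p ∂μ) ^ (1 / p) := by
  rw [eLpNorm_eq_lintegral_rpow_enorm_toReal (by simpa using hp) (by simp),
    ENNReal.toReal_ofReal hp.le]

theorem eLpNorm_ofReal_rpow {α E : Type*} [MeasurableSpace α] {μ : Measure α}
    [NormedAddCommGroup E] {p : ℝ} (hp : 0 < p) (f : α → E) :
    eLpNorm f (ENNReal.ofReal p) μ ^ p = ∫⁻ z, ‖f z‖ₑ ^ p ∂μ := by
  rw [eLpNorm_ofReal hp, ← ENNReal.rpow_mul, one_div_mul_cancel hp.ne', ENNReal.rpow_one]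

theorem norm_gradient (f : Space n → ℝ) (z : Space n) : ‖gradient f z‖ = ‖fderiv ℝ f z‖ := by
  simp [gradient]

theorem enorm_gradient (f : Space n → ℝ) (z : Space n) : ‖gradient f z‖ₑ = ‖fderiv ℝ f z‖ₑ := by
  rw [← ofReal_norm, norm_gradient, ofReal_norm]

theorem continuous_gradient {f : Space n → ℝ} (hf : ContDiff ℝ 1 f) : Continuous (gradient f) := by
  unfold gradient
  exact (InnerProductSpace.toDual ℝ (Space n)).symm.continuous.comp
    (hf.continuous_fderiv (by norm_num))

theorem gradient_comp {F : ℝ → ℝ} {F' : ℝ} {f : Space n → ℝ} {z : Space n}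
    (hF : HasDerivAt F F' (f z)) (hf : DifferentiableAt ℝ f z) :
    gradient (fun z => F (f z)) z = F' • gradient f z := by
  have h := hF.comp_hasFDerivAt z hf.hasFDerivAt
  have h2 : fderiv ℝ (fun z => F (f z)) z = F' • fderiv ℝ f z := h.fderiv
  simp [gradient, h2]

theorem gradient_sub {f g : Space n → ℝ} {z : Space n}
    (hf : DifferentiableAt ℝ f z) (hg : DifferentiableAt ℝ g z) :
    gradient (fun z => f z - g z) z = gradient f z - gradient g z := by
  simp [gradient, fderiv_fun_sub hf hg]

theorem hasCompactSupport_gradient {f : Space n → ℝ} (hf : HasCompactSupport f) :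
    HasCompactSupport (gradient f) :=
  (hf.fderiv ℝ).comp_left (g := (InnerProductSpace.toDual ℝ (Space n)).symm) (by simp)

/-- `C` is an admissible constant in the Hardy-Sobolev inequality on `Ω` with weight `|x|^{-t}`. -/
def HardySobolevBound (k : ℕ) (Ω : Set (Space n)) (p t : ℝ) (C : ℝ≥0∞) : Prop :=
  ∀ u : Space n → ℝ, ContDiff ℝ 1 u → HasCompactSupport u → tsupport u ⊆ Ω →
    ∫⁻ z in Ω, ‖u z‖ₑ ^ pStar n p t * weight k t z ≤
      C * eLpNorm (gradient u) (ENNReal.ofReal p) (volume.restrict Ω) ^ pStar n p t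

theorem exists_hardySobolevBound {k : ℕ} (hk : 1 < k) (hkn : k ≤ n) {p t : ℝ} (hp : 1 < p)
    (hpn : p < n) (ht : 0 ≤ t) (htk : t < min p k) {Ω : Set (Space n)} (hΩ : MeasurableSet Ω) :
    ∃ C : ℝ≥0∞, C ≠ ⊤ ∧ HardySobolevBound k Ω p t C := by
  obtain ⟨C, hC, h⟩ := exists_hardySobolev hk hkn hp hpn ht htk
  refine ⟨C, hC, fun u hu huc huΩ => (setLIntegral_le_lintegral _ _).trans
    ((h u hu huc).trans_eq ?_)⟩
  have hp0 : 0 < p := by linarith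
  rw [eLpNorm_ofReal hp0, ← ENNReal.rpow_mul, ← lintegral_indicator hΩ]
  have e1 : 1 / p * pStar n p t = (n - t) / (n - p) := by
    rw [pStar]; field_simp
  rw [e1]
  congr 3 with z
  by_cases hz : z ∈ Ω
  · rw [Set.indicator_of_mem hz, enorm_gradient]
  · have h0 : fderiv ℝ u z = 0 :=
      image_eq_zero_of_notMem_tsupport fun hz' => hz (huΩ (tsupport_fderiv_subset ℝ hz'))
    rw [Set.indicator_of_notMem hz, ← ofReal_norm, h0, norm_zero, ENNReal.ofReal_zero,
      ENNReal.zero_rpow_of_pos hp0]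

/-- The Hardy-Sobolev inequality passes to almost everywhere limits. -/
theorem HardySobolevBound.of_tendsto {k : ℕ} {Ω : Set (Space n)} {p t : ℝ} {C : ℝ≥0∞}
    (h : HardySobolevBound k Ω p t C) (hC : C ≠ ⊤) (hq : 0 < pStar n p t)
    {f : ℕ → Space n → ℝ} {v : Space n → ℝ}
    (hf : ∀ j, ContDiff ℝ 1 (f j)) (hfc : ∀ j, HasCompactSupport (f j))
    (hfΩ : ∀ j, tsupport (f j) ⊆ Ω)
    (hv : ∀ᵐ z ∂volume.restrict Ω, Tendsto (fun j => f j z) atTop (𝓝 (v z)))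
    {E : ℕ → ℝ≥0∞} {e : ℝ≥0∞}
    (hE : ∀ j, eLpNorm (gradient (f j)) (ENNReal.ofReal p) (volume.restrict Ω) ≤ E j)
    (he : Tendsto E atTop (𝓝 e)) :
    ∫⁻ z in Ω, ‖v z‖ₑ ^ pStar n p t * weight k t z ≤ C * e ^ pStar n p t := by
  calc ∫⁻ z in Ω, ‖v z‖ₑ ^ pStar n p t * weight k t z
      = ∫⁻ z in Ω, liminf (fun j => ‖f j z‖ₑ ^ pStar n p t * weight k t z) atTop := by
        refine lintegral_congr_ae (hv.mono fun z hz => ?_)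
        refine (Tendsto.liminf_eq ?_).symm
        exact ENNReal.Tendsto.mul_const ((hz.enorm).ennrpow_const _) (Or.inr (weight_ne_top k t z))
    _ ≤ liminf (fun j => ∫⁻ z in Ω, ‖f j z‖ₑ ^ pStar n p t * weight k t z) atTop :=
        lintegral_liminf_le fun j =>
          ((hf j).continuous.measurable.enorm.pow_const _).mul (measurable_weight k t)
    _ ≤ liminf (fun j => C * E j ^ pStar n p t) atTop := by
        refine liminf_le_liminf (Eventually.of_forall fun j => ?_)
        refine (h (f j) (hf j) (hfc j) (hfΩ j)).trans ?_
        gcongr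
        exact hE j
    _ = C * e ^ pStar n p t :=
        (ENNReal.Tendsto.const_mul (he.ennrpow_const _) (Or.inr hC)).liminf_eq

/-- `u` is the almost everywhere limit of the test functions `φ j`, whose gradients converge to `g`
in `L^p(Ω)`. -/
structure IsApprox (Ω : Set (Space n)) (p : ℝ) (φ : ℕ → Space n → ℝ) (u : Space n → ℝ)
    (g : Space n → Space n) : Prop where
  test : ∀ j, IsTest Ω (φ j)
  tendsto_ae : ∀ᵐ z ∂volume.restrict Ω, Tendsto (fun j => φ j z) atTop (𝓝 (u z))
  meas : AEStronglyMeasurable u (volume.restrict Ω)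
  memLp : MemLp g (ENNReal.ofReal p) (volume.restrict Ω)
  tendsto_grad : Tendsto (fun j => eLpNorm (fun z => gradient (φ j) z - g z) (ENNReal.ofReal p)
    (volume.restrict Ω)) atTop (𝓝 0)

theorem IsTest.contDiff_one {Ω : Set (Space n)} {φ : Space n → ℝ} (h : IsTest Ω φ) :
    ContDiff ℝ 1 φ := h.smooth.of_le (by exact_mod_cast le_top)

theorem IsTest.differentiable {Ω : Set (Space n)} {φ : Space n → ℝ} (h : IsTest Ω φ) :
    Differentiable ℝ φ := h.contDiff_one.differentiable (by norm_num)

theorem IsTest.memLp_gradient {Ω : Set (Space n)} {φ : Space n → ℝ} (h : IsTest Ω φ) (p : ℝ≥0∞) :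
    MemLp (gradient φ) p (volume.restrict Ω) := by
  exact ((continuous_gradient h.contDiff_one).memLp_of_hasCompactSupport
    (hasCompactSupport_gradient h.compact)).restrict _

theorem IsTest.sub {Ω : Set (Space n)} {φ ψ : Space n → ℝ} (h : IsTest Ω φ) (h' : IsTest Ω ψ) :
    IsTest Ω fun z => φ z - ψ z where
  smooth := h.smooth.sub h'.smooth
  compact := h.compact.sub h'.compact
  support := (tsupport_sub _ _).trans (Set.union_subset h.support h'.support)

theorem tsupport_comp_subset {F : ℝ → ℝ} (hF : F 0 = 0) (f : Space n → ℝ) :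
    tsupport (fun z => F (f z)) ⊆ tsupport f :=
  closure_mono fun z hz hz' => hz (by simp only; rw [hz', hF])

theorem IsTest.comp {Ω : Set (Space n)} {φ : Space n → ℝ} (h : IsTest Ω φ) {F : ℝ → ℝ}
    (hF : ContDiff ℝ ∞ F) (hF0 : F 0 = 0) : IsTest Ω fun z => F (φ z) where
  smooth := hF.comp h.smooth
  compact := h.compact.comp_left hF0
  support := (tsupport_comp_subset hF0 φ).trans h.support

/-- A subsequence of the approximating test functions converges almost everywhere; `∇u ∈ L^p`, since
the difference to some `∇φⱼ` has finite norm. -/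
theorem MemD.exists_isApprox {Ω : Set (Space n)} {p : ℝ} (hp : 1 < p) (hpn : p < n)
    {u : Space n → ℝ} (hu : MemD Ω p u) :
    ∃ g φ, IsWeakGradient Ω u g ∧ IsApprox Ω p φ u g := by
  obtain ⟨g, hg, φ, hφ, hgrad, hlim⟩ := hu
  have hq : 0 < pStar n p 0 := pStar_pos (by linarith) hpn (by linarith)
  have hum : AEStronglyMeasurable u (volume.restrict Ω) := hg.locInt.aestronglyMeasurable
  have hgm : AEStronglyMeasurable g (volume.restrict Ω) := hg.locInt_grad.aestronglyMeasurable
  obtain ⟨ns, hns, hae⟩ := (tendstoInMeasure_of_tendsto_eLpNorm (by simpa using hq)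
    (fun j => (hφ j).smooth.continuous.aestronglyMeasurable) hum hlim).exists_seq_tendsto_ae
  refine ⟨g, fun j => φ (ns j), hg, fun j => hφ _, hae, hum, ?_, hgrad.comp hns.tendsto_atTop⟩
  obtain ⟨j, hj⟩ := (hgrad.eventually (gt_mem_nhds ENNReal.zero_lt_top)).exists
  have h1 : MemLp (fun z => gradient (φ j) z - g z) (ENNReal.ofReal p) (volume.restrict Ω) :=
    ⟨((hφ j).memLp_gradient (ENNReal.ofReal p)).1.sub hgm, hj⟩
  have e : (gradient (φ j) - fun z => gradient (φ j) z - g z) = g := by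
    ext1 z
    simp
  exact e ▸ ((hφ j).memLp_gradient (ENNReal.ofReal p)).sub h1

/-- Weak gradients are unique, so the weak inequality may be used with the gradient from the
definition of `𝒟^{1,p}(Ω)`. -/
theorem IsWeakGradient.ae_eq {Ω : Set (Space n)} (hΩ : IsOpen Ω) {u : Space n → ℝ}
    {g g' : Space n → Space n} (h : IsWeakGradient Ω u g) (h' : IsWeakGradient Ω u g') :
    g =ᵐ[volume.restrict Ω] g' := by
  have hint {f : Space n → Space n} (hf : LocallyIntegrableOn f Ω) {φ : Space n → ℝ}
      (hφ : IsTest Ω φ) : Integrable (fun z => φ z • f z) (volume.restrict Ω) := by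
    have h1 : IntegrableOn (fun z => φ z • f z) (tsupport φ) :=
      (hf.integrableOn_compact_subset hφ.support hφ.compact).continuousOn_smul
        hφ.smooth.continuous.continuousOn hφ.compact
    refine (h1.integrable_of_forall_notMem_eq_zero fun z hz => ?_).restrict
    rw [image_eq_zero_of_notMem_tsupport hz, zero_smul]
  have key := hΩ.ae_eq_zero_of_integral_contDiff_smul_eq_zero (μ := volume)
    (f := fun z => g z - g' z) (h.locInt_grad.sub h'.locInt_grad) fun φ hφ hφc hφΩ => by
      have ht : IsTest Ω φ := ⟨hφ, hφc, hφΩ⟩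
      have e : ∫ z in Ω, φ z • (g z - g' z) = 0 := by
        simp_rw [smul_sub]
        rw [integral_sub (hint h.locInt_grad ht) (hint h'.locInt_grad ht), sub_eq_zero,
          ← neg_inj, ← h.parts φ ht, ← h'.parts φ ht]
      rwa [setIntegral_eq_integral_of_forall_compl_eq_zero] at e
      intro z hz
      rw [image_eq_zero_of_notMem_tsupport fun hz' => hz (hφΩ hz'), zero_smul]
  rw [Filter.EventuallyEq, ae_restrict_iff' hΩ.measurableSet]
  exact key.mono fun z hz hzΩ => sub_eq_zero.1 (hz hzΩ)

variable {k : ℕ} {Ω : Set (Space n)} {p : ℝ} {φ : ℕ → Space n → ℝ} {u : Space n → ℝ}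
  {g : Space n → Space n}

/-- The Hardy-Sobolev inequality for `G(u)`, `u ∈ 𝒟^{1,p}(Ω)`. -/
theorem IsApprox.hardySobolev_comp (h : IsApprox Ω p φ u g) (hp : 1 ≤ p) {t : ℝ} {C : ℝ≥0∞}
    (hC : HardySobolevBound k Ω p t C) (hCtop : C ≠ ⊤) (hq : 0 < pStar n p t)
    {G G' : ℝ → ℝ} (hG : ∀ x, HasDerivAt G (G' x) x) (hG' : Continuous G') (hG0 : G 0 = 0)
    {M : ℝ} (hM : ∀ x, |G' x| ≤ M) :
    ∫⁻ z in Ω, ‖G (u z)‖ₑ ^ pStar n p t * weight k t z ≤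
      C * eLpNorm (fun z => G' (u z) • g z) (ENNReal.ofReal p) (volume.restrict Ω) ^
        pStar n p t := by
  have hp0 : 0 < p := by linarith
  have hG1 : ContDiff ℝ 1 G := by
    rw [contDiff_one_iff_deriv]
    exact ⟨fun x => (hG x).differentiableAt, by rwa [funext fun x => (hG x).deriv]⟩
  have hGc : Continuous G := hG1.continuous
  refine hC.of_tendsto hCtop hq (f := fun j z => G (φ j z))
    (E := fun j => ENNReal.ofReal M * eLpNorm (fun z => gradient (φ j) z - g z) (ENNReal.ofReal p)
      (volume.restrict Ω) + eLpNorm (fun z => G' (φ j z) • g z) (ENNReal.ofReal p)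
      (volume.restrict Ω)) (fun j => hG1.comp (h.test j).contDiff_one)
    (fun j => (h.test j).compact.comp_left hG0)
    (fun j => (tsupport_comp_subset hG0 _).trans (h.test j).support)
    (h.tendsto_ae.mono fun z hz => (hGc.tendsto _).comp hz) (fun j => ?_) ?_
  · have hm1 : AEStronglyMeasurable (fun z => G' (φ j z)) (volume.restrict Ω) :=
      (hG'.comp (h.test j).smooth.continuous).aestronglyMeasurable
    have hm2 : AEStronglyMeasurable (fun z => gradient (φ j) z - g z) (volume.restrict Ω) :=
      (continuous_gradient (h.test j).contDiff_one).aestronglyMeasurable.sub h.memLp.1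
    have e : gradient (fun z => G (φ j z)) = (fun z => G' (φ j z) • (gradient (φ j) z - g z)) +
        fun z => G' (φ j z) • g z := by
      ext1 z
      rw [gradient_comp (hG _) ((h.test j).differentiable z), Pi.add_apply, ← smul_add,
        sub_add_cancel]
    rw [e]
    refine (eLpNorm_add_le (hm1.smul hm2) (hm1.smul h.memLp.1) (by simpa using hp)).trans ?_
    refine add_le_add (eLpNorm_le_mul_eLpNorm_of_ae_le_mul (ae_of_all _ fun z => ?_) _) le_rfl
    rw [Pi.smul_apply', norm_smul]
    gcongr
    exact hM _
  · have h1 : Tendsto (fun j => eLpNorm (fun z => G' (φ j z) • g z) (ENNReal.ofReal p)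
        (volume.restrict Ω)) atTop
        (𝓝 (eLpNorm (fun z => G' (u z) • g z) (ENNReal.ofReal p) (volume.restrict Ω))) := by
      simp_rw [eLpNorm_ofReal hp0]
      refine Tendsto.ennrpow_const _ ?_
      refine tendsto_lintegral_of_dominated_convergence'
        (fun z => ENNReal.ofReal M ^ p * ‖g z‖ₑ ^ p) (fun j => ?_) (fun j => ae_of_all _ fun z => ?_)
        ?_ (h.tendsto_ae.mono fun z hz => ?_)
      · exact (((hG'.comp (h.test j).smooth.continuous).aestronglyMeasurable.smul
          h.memLp.1).enorm.pow_const _)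
      · simp only
        rw [← ENNReal.mul_rpow_of_nonneg _ _ hp0.le, enorm_smul, ← ofReal_norm (G' (φ j z))]
        gcongr
        exact hM _
      · rw [lintegral_const_mul' _ _ (by simp [hp0.le]), ← eLpNorm_ofReal_rpow hp0]
        exact ENNReal.mul_ne_top (by simp [hp0.le]) (by simp [hp0.le, h.memLp.2.ne])
      · exact ((((hG'.tendsto _).comp hz).smul_const (g z)).enorm).ennrpow_const _
    simpa using (ENNReal.Tendsto.const_mul h.tendsto_grad (Or.inr ENNReal.ofReal_ne_top)).add h1

theorem IsApprox.hardySobolev (h : IsApprox Ω p φ u g) (hp : 1 ≤ p) {t : ℝ} {C : ℝ≥0∞}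
    (hC : HardySobolevBound k Ω p t C) (hCtop : C ≠ ⊤) (hq : 0 < pStar n p t) :
    ∫⁻ z in Ω, ‖u z‖ₑ ^ pStar n p t * weight k t z < ⊤ := by
  have := h.hardySobolev_comp hp hC hCtop hq (G := fun x => x) (G' := fun _ => 1) hasDerivAt_id'
    continuous_const rfl (M := 1) (by simp)
  simp only [one_smul] at this
  exact this.trans_lt (ENNReal.mul_lt_top hCtop.lt_top
    (ENNReal.rpow_lt_top_of_nonneg hq.le h.memLp.2.ne))

/-- `φⱼ → u` in `L^{p*(t)}(|x|^{-t})`, with the rate at which the gradients converge. -/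
theorem IsApprox.hardySobolev_sub (h : IsApprox Ω p φ u g) (hp : 1 ≤ p) {t : ℝ} {C : ℝ≥0∞}
    (hC : HardySobolevBound k Ω p t C) (hCtop : C ≠ ⊤) (hq : 0 < pStar n p t) (j : ℕ) :
    ∫⁻ z in Ω, ‖φ j z - u z‖ₑ ^ pStar n p t * weight k t z ≤
      C * eLpNorm (fun z => gradient (φ j) z - g z) (ENNReal.ofReal p) (volume.restrict Ω) ^
        pStar n p t := by
  refine hC.of_tendsto hCtop hq (f := fun i z => φ j z - φ i z)
    (E := fun i => eLpNorm (fun z => gradient (φ j) z - g z) (ENNReal.ofReal p)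
      (volume.restrict Ω) + eLpNorm (fun z => gradient (φ i) z - g z) (ENNReal.ofReal p)
      (volume.restrict Ω)) (fun i => ((h.test j).sub (h.test i)).contDiff_one)
    (fun i => ((h.test j).sub (h.test i)).compact) (fun i => ((h.test j).sub (h.test i)).support)
    (h.tendsto_ae.mono fun z hz => hz.const_sub _) (fun i => ?_) ?_
  · have hm (i : ℕ) : AEStronglyMeasurable (fun z => gradient (φ i) z - g z) (volume.restrict Ω) :=
      (continuous_gradient (h.test i).contDiff_one).aestronglyMeasurable.sub h.memLp.1
    have e : gradient (fun z => φ j z - φ i z) = (fun z => gradient (φ j) z - g z) -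
        fun z => gradient (φ i) z - g z := by
      ext1 z
      rw [gradient_sub ((h.test j).differentiable z) ((h.test i).differentiable z), Pi.sub_apply,
        sub_sub_sub_cancel_right]
    rw [e]
    exact eLpNorm_sub_le (hm j) (hm i) (by simpa using hp)
  · simpa using h.tendsto_grad.const_add (eLpNorm (fun z => gradient (φ j) z - g z)
      (ENNReal.ofReal p) (volume.restrict Ω))

end

section

variable {n : ℕ}

/-! ### Composite test functions in the weak inequality -/

/-- The exponent conjugate to `r' = n / (p - s)`. -/
noncomputable def dualExp (n : ℕ) (p s : ℝ) : ℝ := n / (n - p + s)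

theorem rPrime_eq {p s : ℝ} (hp : 0 < p) (hpn : p < n) : rPrime n p s = n / (p - s) := by
  have h1 : 0 < n - p := by linarith
  rw [rPrime, pStar, pStar, div_sub' h1.ne', div_div_div_cancel_right₀ h1.ne',
    show p * (n - s) - (n - p) * p = p * (p - s) by ring, sub_zero, mul_div_mul_left _ _ hp.ne']

theorem rPrime_pos {p s : ℝ} (hp : 0 < p) (hpn : p < n) (hsp : s < p) : 0 < rPrime n p s := by
  rw [rPrime_eq hp hpn]
  exact div_pos (hp.trans hpn) (by linarith)

theorem dualExp_pos {p s : ℝ} (hp : 0 < p) (hpn : p < n) (hs : 0 ≤ s) : 0 < dualExp n p s :=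
  div_pos (hp.trans hpn) (by linarith)

theorem inv_rPrime_add_inv_dualExp {p s : ℝ} (hp : 0 < p) (hpn : p < n) :
    1 / rPrime n p s + 1 / dualExp n p s = 1 := by
  have h0 : (0 : ℝ) < n := hp.trans hpn
  rw [rPrime_eq hp hpn, dualExp, one_div_div, one_div_div]
  field_simp; ring

theorem pStar_mul_dualExp {p s : ℝ} (hpn : p < n) (hs : 0 ≤ s) :
    pStar n p (s * dualExp n p s) = p * dualExp n p s := by
  have h1 : 0 < n - p := by linarith
  have h2 : 0 < n - p + s := by linarith
  rw [pStar, dualExp]; field_simp; ring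

/-- The exponent of the weight which Hölder's inequality produces is admissible in the Hardy-Sobolev
inequality. -/
theorem mul_dualExp_lt {k : ℕ} {p s : ℝ} (hpn : p < n) (hs : 0 ≤ s)
    (hsp : s < p) (hsnk : s * (n - k) < k * (n - p)) : s * dualExp n p s < min p k := by
  have h1 : 0 < n - p := by linarith
  have h2 : 0 < n - p + s := by linarith
  rw [dualExp, lt_min_iff, ← mul_div_assoc, div_lt_iff₀ h2, div_lt_iff₀ h2]
  constructor <;> nlinarith

/-- Hölder's inequality behind the right hand side of the weak inequality. -/
theorem lintegral_mul_weight_le {μ : Measure (Space n)} {k : ℕ} {p s a d : ℝ} (hp : 1 ≤ p)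
    (ha : 0 < a) (hd : 0 < d) (had : 1 / a + 1 / d = 1) {V f v : Space n → ℝ≥0∞}
    (hV : AEMeasurable V μ) (hf : AEMeasurable f μ) (hv : AEMeasurable v μ) :
    ∫⁻ z, V z * f z ^ (p - 1) * weight k s z * v z ∂μ ≤ (∫⁻ z, V z ^ a ∂μ) ^ (1 / a) *
      (∫⁻ z, f z ^ (p * d) * weight k (s * d) z ∂μ) ^ ((p - 1) / (p * d)) *
      (∫⁻ z, v z ^ (p * d) * weight k (s * d) z ∂μ) ^ (1 / (p * d)) := by
  have hp0 : 0 < p := by linarith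
  have hw := (measurable_weight (n := n) k (s * d)).aemeasurable (μ := μ)
  have hb : 0 ≤ (p - 1) / (p * d) := div_nonneg (by linarith) (by positivity)
  have hc : 0 ≤ 1 / (p * d) := by positivity
  have hbc : (p - 1) / (p * d) + 1 / (p * d) = 1 / d := by field_simp; ring
  refine le_trans (lintegral_mono fun z => le_of_eq ?_) (lintegral_rpow_mul_rpow_mul_rpow_le
    (g := fun z => f z ^ (p * d) * weight k (s * d) z)
    (h := fun z => v z ^ (p * d) * weight k (s * d) z) (hV.pow_const a)
    ((hf.pow_const _).mul hw) ((hv.pow_const _).mul hw) (by positivity) hb hc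
    (by rw [add_assoc, hbc, had]))
  rw [ENNReal.mul_rpow_of_nonneg _ _ hb, ENNReal.mul_rpow_of_nonneg _ _ hc, ← ENNReal.rpow_mul,
    ← ENNReal.rpow_mul, ← ENNReal.rpow_mul, mul_one_div_cancel ha.ne',
    mul_one_div_cancel (by positivity), mul_div_cancel₀ _ (by positivity), ENNReal.rpow_one,
    ENNReal.rpow_one]
  have e : weight k s z = weight k (s * d) z ^ ((p - 1) / (p * d)) *
      weight k (s * d) z ^ (1 / (p * d)) := by
    rw [← ENNReal.rpow_add_of_nonneg _ _ hb hc, hbc, ← weight_mul k _ (by positivity)]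
    congr 1; field_simp
  rw [e]
  ring

theorem lintegral_mul_rpow_weight_le {μ : Measure (Space n)} {k : ℕ} {p s a d : ℝ} (hp : 1 ≤ p)
    (ha : 0 < a) (hd : 0 < d) (had : 1 / a + 1 / d = 1) {V f : Space n → ℝ≥0∞}
    (hV : AEMeasurable V μ) (hf : AEMeasurable f μ) :
    ∫⁻ z, V z * f z ^ p * weight k s z ∂μ ≤ (∫⁻ z, V z ^ a ∂μ) ^ (1 / a) *
      (∫⁻ z, f z ^ (p * d) * weight k (s * d) z ∂μ) ^ (1 / d) := by
  have hp0 : 0 < p := by linarith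
  refine le_trans (lintegral_mono fun z => le_of_eq ?_)
    ((lintegral_mul_weight_le (k := k) (s := s) hp ha hd had hV hf hf).trans_eq ?_)
  · have : f z ^ p = f z ^ (p - 1) * f z := by
      conv_rhs => rw [← ENNReal.rpow_one (f z), ← ENNReal.rpow_mul, one_mul]
      rw [← ENNReal.rpow_add_of_nonneg _ _ (by linarith) zero_le_one, sub_add_cancel]
    rw [this]; ring
  · rw [mul_assoc, ← ENNReal.rpow_add_of_nonneg _ _ (div_nonneg (by linarith) (by positivity))
      (by positivity)]
    congr 2
    field_simp; ring

/-- The absolute value of the integrand on the right hand side of the weak inequality. The junk values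
of `|u|^{p-2}` at `u = 0`, for `p < 2`, and of `|x|^{-s}` at `x = 0` agree on both sides. -/
theorem enorm_rhs {k : ℕ} {p s : ℝ} (hp : 1 < p) (V u : Space n → ℝ) (x : ℝ) (z : Space n) :
    ‖V z * (|u z| ^ (p - 2) / xNorm k z ^ s) * u z * x‖ₑ =
      ‖V z‖ₑ * ‖u z‖ₑ ^ (p - 1) * weight k s z * ‖x‖ₑ := by
  have h1 : ‖|u z| ^ (p - 2)‖ₑ * ‖u z‖ₑ = ‖u z‖ₑ ^ (p - 1) := by
    rw [← enorm_mul, ← ofReal_norm, ← ofReal_norm (u z),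
      ENNReal.ofReal_rpow_of_nonneg (norm_nonneg _) (by linarith), norm_mul, Real.norm_eq_abs,
      Real.norm_eq_abs, abs_of_nonneg (Real.rpow_nonneg (abs_nonneg _) _)]
    congr 1
    rcases eq_or_ne (u z) 0 with h | h
    · simp [h, Real.zero_rpow (by linarith : p - 1 ≠ 0)]
    · rw [← Real.rpow_add_one (abs_ne_zero.2 h)]; ring_nf
  have h2 : ‖(xNorm k z ^ s)⁻¹‖ₑ = weight k s z := by
    rw [← Real.rpow_neg (xNorm_nonneg k z), weight, Real.enorm_of_nonneg
      (Real.rpow_nonneg (xNorm_nonneg k z) _)]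
  rw [div_eq_mul_inv, enorm_mul, enorm_mul, enorm_mul, enorm_mul, h2, ← h1]
  ring

theorem tendsto_integral_of_lintegral_sub {α : Type*} [MeasurableSpace α] {μ : Measure α}
    {F : ℕ → α → ℝ} {f : α → ℝ} (hf : Integrable f μ) (hF : ∀ j, AEStronglyMeasurable (F j) μ)
    (h : Tendsto (fun j => ∫⁻ z, ‖F j z - f z‖ₑ ∂μ) atTop (𝓝 0)) :
    Tendsto (fun j => ∫ z, F j z ∂μ) atTop (𝓝 (∫ z, f z ∂μ)) := by
  refine tendsto_integral_of_L1 f hf.1 ?_ h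
  filter_upwards [h.eventually (gt_mem_nhds ENNReal.zero_lt_top)] with j hj
  have h1 : Integrable (fun z => F j z - f z) μ := ⟨(hF j).sub hf.1, hj⟩
  exact (h1.add hf).congr (ae_of_all _ fun z => by simp)

variable {k : ℕ} {Ω : Set (Space n)} {p s : ℝ} {φ : ℕ → Space n → ℝ} {V u : Space n → ℝ}
  {g : Space n → Space n}

theorem lintegral_enorm_rpow_lt_top {α E : Type*} [MeasurableSpace α] {μ : Measure α}
    [NormedAddCommGroup E] {q : ℝ} (hq : 0 < q) {f : α → E} (hf : MemLp f (ENNReal.ofReal q) μ) :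
    ∫⁻ z, ‖f z‖ₑ ^ q ∂μ < ⊤ := by
  rw [← eLpNorm_ofReal_rpow hq]
  exact ENNReal.rpow_lt_top_of_nonneg hq.le hf.2.ne

/-- The primitive of `H` which vanishes at `0`. -/
noncomputable def primitive (H : ℝ → ℝ) (x : ℝ) : ℝ := ∫ y in (0 : ℝ)..x, H y

theorem hasDerivAt_primitive {H : ℝ → ℝ} (hH : Continuous H) (x : ℝ) :
    HasDerivAt (primitive H) (H x) x := (hH.integral_hasStrictDerivAt 0 x).hasDerivAt

@[simp] theorem primitive_zero (H : ℝ → ℝ) : primitive H 0 = 0 := intervalIntegral.integral_same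

theorem continuous_primitive {H : ℝ → ℝ} (hH : Continuous H) : Continuous (primitive H) :=
  continuous_iff_continuousAt.2 fun x => (hasDerivAt_primitive hH x).continuousAt

theorem abs_primitive_sub_le {H : ℝ → ℝ} (hH : Continuous H) {M : ℝ} (hM : ∀ x, |H x| ≤ M)
    (x y : ℝ) : |primitive H x - primitive H y| ≤ M * |x - y| := by
  rw [primitive, primitive, intervalIntegral.integral_interval_sub_left
    (hH.intervalIntegrable _ _) (hH.intervalIntegrable _ _)]
  exact intervalIntegral.norm_integral_le_of_norm_le_const (f := H) (C := M) fun t _ => hM t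

theorem abs_primitive_le {H : ℝ → ℝ} (hH : Continuous H) {M : ℝ} (hM : ∀ x, |H x| ≤ M)
    (x : ℝ) : |primitive H x| ≤ M * |x| := by
  simpa using abs_primitive_sub_le hH hM x 0

theorem primitive_nonneg {H : ℝ → ℝ} (hH0 : ∀ x, 0 ≤ H x) (hHneg : ∀ x ≤ 0, H x = 0) (x : ℝ) :
    0 ≤ primitive H x := by
  rcases le_total 0 x with hx | hx
  · exact intervalIntegral.integral_nonneg hx fun t _ => hH0 t
  · refine le_of_eq (Eq.symm ?_)
    rw [primitive, intervalIntegral.integral_congr (g := fun _ => (0 : ℝ)) fun t ht => ?_]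
    · simp
    · rw [Set.uIcc_of_ge hx] at ht
      exact hHneg t ht.2

theorem contDiff_primitive {H : ℝ → ℝ} (hH : ContDiff ℝ ∞ H) : ContDiff ℝ ∞ (primitive H) := by
  rw [contDiff_infty_iff_deriv]
  refine ⟨fun x => (hasDerivAt_primitive hH.continuous x).differentiableAt, ?_⟩
  rwa [funext fun x => (hasDerivAt_primitive hH.continuous x).deriv]

theorem integrable_norm_rpow_mul (hp : 0 < p) (hgL : MemLp g (ENNReal.ofReal p) (volume.restrict Ω))
    (hu : AEStronglyMeasurable u (volume.restrict Ω)) {H : ℝ → ℝ} (hH : Continuous H) {M : ℝ}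
    (hM : ∀ x, |H x| ≤ M) :
    Integrable (fun z => ‖g z‖ ^ p * H (u z)) (volume.restrict Ω) := by
  have h1 : Integrable (fun z => ‖g z‖ ^ p) (volume.restrict Ω) := by
    simpa [ENNReal.toReal_ofReal hp.le] using hgL.integrable_norm_rpow (by simpa using hp) (by simp)
  exact h1.mul_bdd (c := M) (hH.comp_aestronglyMeasurable hu) (ae_of_all _ fun z => hM _)

/-- The data of the problem: an element `u ≥ 0` of `𝒟^{1,p}(Ω)` with gradient `g` and approximating test
functions `φ`, a potential `V ∈ L^{r'}(Ω)`, and the weak inequality. The Hardy-Sobolev inequality, which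
holds for every `Ω`, is recorded as a field for convenience. -/
structure IsSolution (k : ℕ) (Ω : Set (Space n)) (p s : ℝ) (φ : ℕ → Space n → ℝ)
    (V u : Space n → ℝ) (g : Space n → Space n) : Prop where
  one_lt : 1 < p
  lt_dim : p < n
  s_nonneg : 0 ≤ s
  s_lt : s < p
  approx : IsApprox Ω p φ u g
  nonneg : ∀ᵐ z ∂volume.restrict Ω, 0 ≤ u z
  memLp_V : MemLp V (ENNReal.ofReal (rPrime n p s)) (volume.restrict Ω)
  hardySobolev : ∀ t : ℝ, 0 ≤ t → t < min p k → ∃ C : ℝ≥0∞, C ≠ ⊤ ∧ HardySobolevBound k Ω p t C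
  dual_lt : s * dualExp n p s < min p k
  weak : ∀ ψ : Space n → ℝ, IsTest Ω ψ → (∀ z, 0 ≤ ψ z) →
      ∫ z in Ω, ‖g z‖ ^ (p - 2) * inner ℝ (g z) (gradient ψ z) ≤
        ∫ z in Ω, V z * (|u z| ^ (p - 2) / xNorm k z ^ s) * u z * ψ z

namespace IsSolution

theorem pos (h : IsSolution k Ω p s φ V u g) : 0 < p := by linarith [h.one_lt]

theorem dual_pos (h : IsSolution k Ω p s φ V u g) : 0 < dualExp n p s :=
  dualExp_pos h.pos h.lt_dim h.s_nonneg

/-- The integral of `|u|^{p*(t)} |x|^{-t}` is finite. -/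
theorem lintegral_lt_top (h : IsSolution k Ω p s φ V u g) {t : ℝ} (ht : 0 ≤ t) (htk : t < min p k) :
    ∫⁻ z in Ω, ‖u z‖ₑ ^ pStar n p t * weight k t z < ⊤ := by
  obtain ⟨C, hC, hCb⟩ := h.hardySobolev t ht htk
  exact h.approx.hardySobolev h.one_lt.le hCb hC
    (pStar_pos h.pos h.lt_dim (htk.le.trans (min_le_left _ _)))

theorem lintegral_dual_lt_top (h : IsSolution k Ω p s φ V u g) :
    ∫⁻ z in Ω, ‖u z‖ₑ ^ (p * dualExp n p s) * weight k (s * dualExp n p s) z < ⊤ := by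
  rw [← pStar_mul_dualExp h.lt_dim h.s_nonneg]
  exact h.lintegral_lt_top (mul_nonneg h.s_nonneg h.dual_pos.le) h.dual_lt

theorem aestronglyMeasurable_rhs (h : IsSolution k Ω p s φ V u g) {v : Space n → ℝ}
    (hv : AEStronglyMeasurable v (volume.restrict Ω)) :
    AEStronglyMeasurable (fun z => V z * (|u z| ^ (p - 2) / xNorm k z ^ s) * u z * v z)
      (volume.restrict Ω) := by
  have hu := h.approx.meas.aemeasurable
  have hV := h.memLp_V.1.aemeasurable
  have hv' := hv.aemeasurable
  have hx : AEMeasurable (xNorm k : Space n → ℝ) (volume.restrict Ω) :=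
    (measurable_xNorm k).aemeasurable
  exact (((hV.mul ((hu.norm.pow_const _).div (hx.pow_const _))).mul hu).mul hv').aestronglyMeasurable

theorem lintegral_rhs_le (h : IsSolution k Ω p s φ V u g) {v : Space n → ℝ}
    (hv : AEStronglyMeasurable v (volume.restrict Ω)) :
    ∫⁻ z in Ω, ‖V z‖ₑ * ‖u z‖ₑ ^ (p - 1) * weight k s z * ‖v z‖ₑ ≤
      (∫⁻ z in Ω, ‖V z‖ₑ ^ rPrime n p s) ^ (1 / rPrime n p s) *
      (∫⁻ z in Ω, ‖u z‖ₑ ^ (p * dualExp n p s) * weight k (s * dualExp n p s) z) ^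
        ((p - 1) / (p * dualExp n p s)) *
      (∫⁻ z in Ω, ‖v z‖ₑ ^ (p * dualExp n p s) * weight k (s * dualExp n p s) z) ^
        (1 / (p * dualExp n p s)) :=
  lintegral_mul_weight_le h.one_lt.le (rPrime_pos h.pos h.lt_dim h.s_lt) h.dual_pos
    (inv_rPrime_add_inv_dualExp h.pos h.lt_dim) h.memLp_V.1.enorm h.approx.meas.enorm hv.enorm

theorem rhs_const_ne_top (h : IsSolution k Ω p s φ V u g) :
    (∫⁻ z in Ω, ‖V z‖ₑ ^ rPrime n p s) ^ (1 / rPrime n p s) *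
      (∫⁻ z in Ω, ‖u z‖ₑ ^ (p * dualExp n p s) * weight k (s * dualExp n p s) z) ^
        ((p - 1) / (p * dualExp n p s)) ≠ ⊤ := by
  have hr := rPrime_pos h.pos h.lt_dim h.s_lt
  refine ENNReal.mul_ne_top (ENNReal.rpow_ne_top_of_nonneg (by positivity)
    (lintegral_enorm_rpow_lt_top hr h.memLp_V).ne) (ENNReal.rpow_ne_top_of_nonneg
      (div_nonneg (by linarith [h.one_lt]) (mul_pos h.pos h.dual_pos).le) h.lintegral_dual_lt_top.ne)

theorem lintegral_rhs_self_lt_top (h : IsSolution k Ω p s φ V u g) :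
    ∫⁻ z in Ω, ‖V z‖ₑ * ‖u z‖ₑ ^ (p - 1) * weight k s z * ‖u z‖ₑ < ⊤ := by
  refine (h.lintegral_rhs_le h.approx.meas).trans_lt (ENNReal.mul_lt_top h.rhs_const_ne_top.lt_top
    (ENNReal.rpow_lt_top_of_nonneg ?_ h.lintegral_dual_lt_top.ne))
  exact one_div_nonneg.2 (mul_pos h.pos h.dual_pos).le

theorem integrable_rhs (h : IsSolution k Ω p s φ V u g) {F : ℝ → ℝ} (hF : Continuous F) {M : ℝ}
    (hM : ∀ x, |F x| ≤ M * |x|) :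
    Integrable (fun z => V z * (|u z| ^ (p - 2) / xNorm k z ^ s) * u z * F (u z))
      (volume.restrict Ω) := by
  refine ⟨h.aestronglyMeasurable_rhs (hF.comp_aestronglyMeasurable h.approx.meas), ?_⟩
  simp only [HasFiniteIntegral, enorm_rhs h.one_lt]
  refine lt_of_le_of_lt (b := ENNReal.ofReal M * _) ?_
    (ENNReal.mul_lt_top ENNReal.ofReal_lt_top h.lintegral_rhs_self_lt_top)
  rw [← lintegral_const_mul' _ _ ENNReal.ofReal_ne_top]
  refine lintegral_mono fun z => ?_
  simp only
  rw [mul_left_comm]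
  gcongr
  rw [← ofReal_norm, ← ofReal_norm (u z), ← ENNReal.ofReal_mul' (norm_nonneg _)]
  exact ENNReal.ofReal_le_ofReal (hM _)

/-- The weak inequality for the test function `F(u)`, `F' = H` smooth and bounded. -/
theorem weak_comp_of_contDiff (h : IsSolution k Ω p s φ V u g) {H : ℝ → ℝ} (hH : ContDiff ℝ ∞ H)
    (hH0 : ∀ x, 0 ≤ H x) (hHneg : ∀ x ≤ 0, H x = 0) {M : ℝ} (hM : ∀ x, |H x| ≤ M) :
    ∫ z in Ω, ‖g z‖ ^ p * H (u z) ≤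
      ∫ z in Ω, V z * (|u z| ^ (p - 2) / xNorm k z ^ s) * u z * primitive H (u z) := by
  have hp0 := h.pos
  have hp1 := h.one_lt
  have hFs := contDiff_primitive hH
  have htest (j : ℕ) : IsTest Ω fun z => primitive H (φ j z) :=
    (h.approx.test j).comp hFs (primitive_zero H)
  have hgm := h.approx.memLp.1
  have hgrad (j : ℕ) (z : Space n) :
      gradient (fun z => primitive H (φ j z)) z = H (φ j z) • gradient (φ j) z :=
    gradient_comp (hasDerivAt_primitive hH.continuous _) ((h.approx.test j).differentiable z)
  have hφm (j : ℕ) : AEStronglyMeasurable (φ j) (volume.restrict Ω) :=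
    (h.approx.test j).smooth.continuous.aestronglyMeasurable
  have hHint {v : Space n → ℝ} (hv : AEStronglyMeasurable v (volume.restrict Ω)) :=
    integrable_norm_rpow_mul hp0 h.approx.memLp hv hH.continuous hM
  have hgp (x : Space n) : ‖x‖ ^ (p - 2) * inner ℝ x x = ‖x‖ ^ p := by
    rw [real_inner_self_eq_norm_sq, ← Real.rpow_natCast,
      ← Real.rpow_add' (norm_nonneg _) (by push_cast; linarith)]
    push_cast; ring_nf
  have hgp1 (x y : Space n) : ‖‖x‖ ^ (p - 2) * inner ℝ x y‖ₑ ≤ ‖x‖ₑ ^ (p - 1) * ‖y‖ₑ := by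
    rw [← ofReal_norm, ← ofReal_norm x, ← ofReal_norm y,
      ENNReal.ofReal_rpow_of_nonneg (norm_nonneg _) (by linarith),
      ← ENNReal.ofReal_mul (by positivity)]
    refine ENNReal.ofReal_le_ofReal ?_
    rw [norm_mul, Real.norm_of_nonneg (by positivity)]
    calc _ ≤ ‖x‖ ^ (p - 2) * (‖x‖ * ‖y‖) := by gcongr; exact norm_inner_le_norm _ _
      _ = ‖x‖ ^ (p - 1) * ‖y‖ := by
        rw [← mul_assoc, ← Real.rpow_add_one' (norm_nonneg _) (by linarith)]; ring_nf
  -- the left hand side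
  have hlhs : Tendsto (fun j => ∫ z in Ω, ‖g z‖ ^ (p - 2) *
      inner ℝ (g z) (gradient (fun z => primitive H (φ j z)) z)) atTop
      (𝓝 (∫ z in Ω, ‖g z‖ ^ p * H (u z))) := by
    have hA : Tendsto (fun j => ∫ z in Ω, (‖g z‖ ^ (p - 2) *
        inner ℝ (g z) (gradient (fun z => primitive H (φ j z)) z) - ‖g z‖ ^ p * H (φ j z)))
        atTop (𝓝 (∫ z in Ω, (0 : ℝ))) := by
      refine tendsto_integral_of_lintegral_sub (integrable_zero _ _ _) (fun j => ?_) ?_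
      · exact ((hgm.norm.aemeasurable.pow_const _).aestronglyMeasurable.mul
          (hgm.inner (continuous_gradient (htest j).contDiff_one).aestronglyMeasurable)).sub
          (hHint (hφm j)).1
      · have hb : Tendsto (fun j => ENNReal.ofReal M * ((∫⁻ z in Ω, ‖g z‖ₑ ^ p) ^ ((p - 1) / p) *
            eLpNorm (fun z => gradient (φ j) z - g z) (ENNReal.ofReal p) (volume.restrict Ω)))
            atTop (𝓝 (ENNReal.ofReal M * ((∫⁻ z in Ω, ‖g z‖ₑ ^ p) ^ ((p - 1) / p) * 0))) := by
          refine ENNReal.Tendsto.const_mul (ENNReal.Tendsto.const_mul h.approx.tendsto_grad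
            (Or.inr (ENNReal.rpow_ne_top_of_nonneg (div_nonneg (by linarith) hp0.le)
              (lintegral_enorm_rpow_lt_top hp0 h.approx.memLp).ne))) (Or.inr ENNReal.ofReal_ne_top)
        simp only [mul_zero] at hb
        refine tendsto_of_tendsto_of_tendsto_of_le_of_le tendsto_const_nhds hb (fun _ => zero_le)
          fun j => ?_
        have hdm : AEStronglyMeasurable (fun z => gradient (φ j) z - g z) (volume.restrict Ω) :=
          (continuous_gradient (h.approx.test j).contDiff_one).aestronglyMeasurable.sub hgm
        calc _ ≤ ∫⁻ z in Ω, ENNReal.ofReal M *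
              ((‖g z‖ₑ ^ p) ^ ((p - 1) / p) * (‖gradient (φ j) z - g z‖ₑ ^ p) ^ (1 / p)) := by
              refine lintegral_mono fun z => ?_
              simp only [sub_zero, hgrad]
              rw [← hgp, inner_smul_right, ← ENNReal.rpow_mul, ← ENNReal.rpow_mul,
                mul_one_div_cancel hp0.ne', mul_div_cancel₀ _ hp0.ne', ENNReal.rpow_one,
                show ‖g z‖ ^ (p - 2) * (H (φ j z) * inner ℝ (g z) (gradient (φ j) z)) -
                  ‖g z‖ ^ (p - 2) * inner ℝ (g z) (g z) * H (φ j z) =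
                  H (φ j z) * (‖g z‖ ^ (p - 2) * inner ℝ (g z) (gradient (φ j) z - g z)) by
                rw [inner_sub_right]; ring, enorm_mul, ← ofReal_norm (H (φ j z))]
              gcongr
              · exact hM _
              · exact hgp1 _ _
          _ ≤ _ := by
              rw [lintegral_const_mul' _ _ ENNReal.ofReal_ne_top, eLpNorm_ofReal hp0]
              gcongr
              exact ENNReal.lintegral_mul_norm_pow_le (hgm.enorm.pow_const _)
                (hdm.enorm.pow_const _) (div_nonneg (by linarith) hp0.le) (by positivity)
                (by field_simp; ring)
    have hB : Tendsto (fun j => ∫ z in Ω, ‖g z‖ ^ p * H (φ j z)) atTop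
        (𝓝 (∫ z in Ω, ‖g z‖ ^ p * H (u z))) := by
      refine tendsto_integral_of_dominated_convergence (fun z => ‖g z‖ ^ p * M)
        (fun j => (hHint (hφm j)).1) ?_ (fun j => ae_of_all _ fun z => ?_)
        (h.approx.tendsto_ae.mono fun z hz => ?_)
      · exact integrable_norm_rpow_mul hp0 h.approx.memLp h.approx.meas continuous_const
          (H := fun _ => M) (M := |M|) fun _ => le_rfl
      · rw [norm_mul, Real.norm_of_nonneg (by positivity)]
        gcongr
        exact hM _
      · exact ((hH.continuous.tendsto _).comp hz).const_mul _
    have := hA.add hB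
    simp only [integral_zero, zero_add] at this
    refine this.congr fun j => ?_
    rw [integral_sub ?_ (hHint (hφm j)), sub_add_cancel]
    -- integrability of the pairing of `|∇u|^{p-2} ∇u` with the gradient of a test function
    refine ⟨(hgm.norm.aemeasurable.pow_const _).aestronglyMeasurable.mul
          (hgm.inner (continuous_gradient (htest j).contDiff_one).aestronglyMeasurable), ?_⟩
    have hψ := (htest j).memLp_gradient (ENNReal.ofReal p)
    refine lt_of_le_of_lt (lintegral_mono (g := fun z => (‖g z‖ₑ ^ p) ^ ((p - 1) / p) *
      (‖gradient (fun z => primitive H (φ j z)) z‖ₑ ^ p) ^ (1 / p)) fun z => ?_)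
      ((ENNReal.lintegral_mul_norm_pow_le (hgm.enorm.pow_const _) (hψ.1.enorm.pow_const _)
        (div_nonneg (by linarith) hp0.le) (by positivity) (by field_simp; ring)).trans_lt ?_)
    · simp only
      rw [← ENNReal.rpow_mul, ← ENNReal.rpow_mul, mul_one_div_cancel hp0.ne',
        mul_div_cancel₀ _ hp0.ne', ENNReal.rpow_one]
      exact hgp1 _ _
    · exact ENNReal.mul_lt_top (ENNReal.rpow_lt_top_of_nonneg (div_nonneg (by linarith) hp0.le)
        (lintegral_enorm_rpow_lt_top hp0 h.approx.memLp).ne)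
        (ENNReal.rpow_lt_top_of_nonneg (by positivity) (lintegral_enorm_rpow_lt_top hp0 hψ).ne)
  -- the right hand side
  have hrhs : Tendsto (fun j => ∫ z in Ω, V z * (|u z| ^ (p - 2) / xNorm k z ^ s) * u z *
      primitive H (φ j z)) atTop
      (𝓝 (∫ z in Ω, V z * (|u z| ^ (p - 2) / xNorm k z ^ s) * u z * primitive H (u z))) := by
    refine tendsto_integral_of_lintegral_sub
      (h.integrable_rhs hFs.continuous (abs_primitive_le hH.continuous hM))
      (fun j => h.aestronglyMeasurable_rhs (htest j).smooth.continuous.aestronglyMeasurable) ?_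
    obtain ⟨C, hC, hCb⟩ := h.hardySobolev _ (mul_nonneg h.s_nonneg h.dual_pos.le) h.dual_lt
    have hpd := mul_pos hp0 h.dual_pos
    set A := (∫⁻ z in Ω, ‖V z‖ₑ ^ rPrime n p s) ^ (1 / rPrime n p s) *
      (∫⁻ z in Ω, ‖u z‖ₑ ^ (p * dualExp n p s) * weight k (s * dualExp n p s) z) ^
        ((p - 1) / (p * dualExp n p s)) with hAdef
    have hb : Tendsto (fun j => ENNReal.ofReal M * (A * (C * eLpNorm (fun z => gradient (φ j) z -
        g z) (ENNReal.ofReal p) (volume.restrict Ω) ^ (p * dualExp n p s)) ^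
        (1 / (p * dualExp n p s)))) atTop (𝓝 (ENNReal.ofReal M * (A * (C * 0 ^
          (p * dualExp n p s)) ^ (1 / (p * dualExp n p s))))) :=
      ENNReal.Tendsto.const_mul (ENNReal.Tendsto.const_mul (Tendsto.ennrpow_const _
        (ENNReal.Tendsto.const_mul (h.approx.tendsto_grad.ennrpow_const _) (Or.inr hC)))
        (Or.inr h.rhs_const_ne_top)) (Or.inr ENNReal.ofReal_ne_top)
    rw [ENNReal.zero_rpow_of_pos hpd, mul_zero, ENNReal.zero_rpow_of_pos (by positivity), mul_zero,
      mul_zero] at hb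
    refine tendsto_of_tendsto_of_tendsto_of_le_of_le tendsto_const_nhds hb (fun _ => zero_le)
      fun j => ?_
    calc _ ≤ ∫⁻ z in Ω, ENNReal.ofReal M *
          (‖V z‖ₑ * ‖u z‖ₑ ^ (p - 1) * weight k s z * ‖φ j z - u z‖ₑ) := by
          refine lintegral_mono fun z => ?_
          simp only
          rw [← mul_sub, enorm_rhs hp1, mul_left_comm]
          gcongr
          rw [← ofReal_norm, ← ofReal_norm (φ j z - u z), ← ENNReal.ofReal_mul' (norm_nonneg _)]
          exact ENNReal.ofReal_le_ofReal (abs_primitive_sub_le hH.continuous hM _ _)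
      _ ≤ _ := by
          rw [lintegral_const_mul' _ _ ENNReal.ofReal_ne_top]
          gcongr
          refine (h.lintegral_rhs_le (v := fun z => φ j z - u z)
            ((hφm j).sub h.approx.meas)).trans ?_
          gcongr
          have := h.approx.hardySobolev_sub hp1.le hCb hC (by
            rw [pStar_mul_dualExp h.lt_dim h.s_nonneg]; exact hpd) j
          rwa [pStar_mul_dualExp h.lt_dim h.s_nonneg] at this
  exact le_of_tendsto_of_tendsto' hlhs hrhs fun j => h.weak _ (htest j)
    fun z => primitive_nonneg hH0 hHneg _

end IsSolution

end

section

variable {n : ℕ}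

/-- A bounded continuous `H ≥ 0` which vanishes on `(-∞, 0]` is a bounded pointwise limit of smooth
functions with the same properties. -/
theorem exists_contDiff_tendsto {H : ℝ → ℝ} (hH : Continuous H) (hH0 : ∀ x, 0 ≤ H x)
    (hHneg : ∀ x ≤ 0, H x = 0) {M : ℝ} (hM : ∀ x, |H x| ≤ M) :
    ∃ K : ℕ → ℝ → ℝ, (∀ m, ContDiff ℝ ∞ (K m)) ∧ (∀ m x, 0 ≤ K m x) ∧
      (∀ m, ∀ x ≤ 0, K m x = 0) ∧ (∀ m x, |K m x| ≤ M + 2) ∧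
      ∀ x, Tendsto (fun m => K m x) atTop (𝓝 (H x)) := by
  have hε (m : ℕ) : (0 : ℝ) < 1 / ((m : ℝ) + 1) := by positivity
  have hε1 (m : ℕ) : 1 / ((m : ℝ) + 1) ≤ 1 := by
    rw [div_le_one (by positivity)]; linarith [(Nat.cast_nonneg m : (0 : ℝ) ≤ m)]
  choose f hf hfd _ using fun m : ℕ => hH.exists_contDiff_approx ⊤
    (ε := fun _ => 1 / ((m : ℝ) + 1)) continuous_const fun _ => hε m
  have hfd' (m : ℕ) (x : ℝ) : |f m x - H x| < 1 / ((m : ℝ) + 1) := hfd m x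
  have hpos (m : ℕ) (x : ℝ) : 0 ≤ f m x + 1 / ((m : ℝ) + 1) := by
    have := (abs_lt.1 (hfd' m x)).1; linarith [hH0 x]
  have hle (m : ℕ) (x : ℝ) : f m x + 1 / ((m : ℝ) + 1) ≤ M + 2 := by
    have := (abs_lt.1 (hfd' m x)).2; linarith [le_of_abs_le (hM x), hε1 m]
  refine ⟨fun m x => Real.smoothTransition (m * x) * (f m x + 1 / ((m : ℝ) + 1)), fun m => ?_,
    fun m x => mul_nonneg (Real.smoothTransition.nonneg _) (hpos m x), fun m x hx => ?_,
    fun m x => ?_, fun x => ?_⟩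
  · exact (Real.smoothTransition.contDiff.comp (contDiff_const.mul contDiff_id)).mul
      ((hf m).add contDiff_const)
  · simp only
    rw [Real.smoothTransition.zero_of_nonpos (mul_nonpos_of_nonneg_of_nonpos (Nat.cast_nonneg m) hx),
      zero_mul]
  · rw [abs_of_nonneg (mul_nonneg (Real.smoothTransition.nonneg _) (hpos m x))]
    exact (mul_le_of_le_one_left (hpos m x) (Real.smoothTransition.le_one _)).trans (hle m x)
  · rcases le_or_gt x 0 with hx | hx
    · rw [hHneg x hx]
      refine tendsto_const_nhds.congr fun m => ?_
      simp only
      rw [Real.smoothTransition.zero_of_nonpos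
        (mul_nonpos_of_nonneg_of_nonpos (Nat.cast_nonneg m) hx), zero_mul]
    · have h0 : Tendsto (fun m : ℕ => 1 / ((m : ℝ) + 1)) atTop (𝓝 0) :=
        tendsto_one_div_add_atTop_nhds_zero_nat
      have h1 : Tendsto (fun m => f m x) atTop (𝓝 (H x)) := by
        rw [tendsto_iff_dist_tendsto_zero]
        exact tendsto_of_tendsto_of_tendsto_of_le_of_le tendsto_const_nhds h0
          (fun _ => dist_nonneg) fun m => (hfd' m x).le
      have h2 : Tendsto (fun m : ℕ => f m x + 1 / ((m : ℝ) + 1)) atTop (𝓝 (H x)) := by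
        simpa using h1.add h0
      refine h2.congr' ?_
      obtain ⟨N, hN⟩ := exists_nat_ge (1 / x)
      filter_upwards [eventually_ge_atTop N] with m hm
      have : 1 ≤ (m : ℝ) * x := by
        rw [← div_le_iff₀ hx]; exact hN.trans (by exact_mod_cast hm)
      rw [Real.smoothTransition.one_of_one_le this, one_mul]

/-! ### Truncated powers -/

/-- The derivative `β min(x⁺, L)^{β - 1}` of the truncated power. -/
noncomputable def truncDeriv (β L x : ℝ) : ℝ := β * min (max x 0) L ^ (β - 1)

/-- The power `x ↦ x^β` on `[0, L]`, continued affinely on `[L, ∞)` and by `0` on `(-∞, 0]`. -/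
noncomputable def truncPow (β L : ℝ) : ℝ → ℝ := primitive (truncDeriv β L)

section Trunc

variable {β L : ℝ}

theorem continuous_truncDeriv (hβ : 1 < β) : Continuous (truncDeriv β L) := by
  unfold truncDeriv
  exact continuous_const.mul (Continuous.rpow_const (by fun_prop) fun _ => Or.inr (by linarith))

theorem truncDeriv_nonneg (hβ : 1 < β) (hL : 0 < L) (x : ℝ) : 0 ≤ truncDeriv β L x :=
  mul_nonneg (by linarith) (Real.rpow_nonneg (le_min (le_max_right _ _) hL.le) _)

theorem truncDeriv_of_nonpos (hβ : 1 < β) (hL : 0 < L) {x : ℝ} (hx : x ≤ 0) :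
    truncDeriv β L x = 0 := by
  rw [truncDeriv, max_eq_right hx, min_eq_left hL.le, Real.zero_rpow (by linarith), mul_zero]

theorem truncDeriv_mono (hβ : 1 < β) (hL : 0 < L) : Monotone (truncDeriv β L) := by
  intro x y hxy
  have h0 : 0 ≤ min (max x 0) L := le_min (le_max_right _ _) hL.le
  unfold truncDeriv
  gcongr

theorem truncDeriv_le (hβ : 1 < β) (hL : 0 < L) (x : ℝ) :
    truncDeriv β L x ≤ β * L ^ (β - 1) := by
  have h0 : 0 ≤ min (max x 0) L := le_min (le_max_right _ _) hL.le
  unfold truncDeriv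
  gcongr
  exact min_le_right _ _

theorem abs_truncDeriv_le (hβ : 1 < β) (hL : 0 < L) (x : ℝ) :
    |truncDeriv β L x| ≤ β * L ^ (β - 1) := by
  rw [abs_of_nonneg (truncDeriv_nonneg hβ hL x)]
  exact truncDeriv_le hβ hL x

theorem truncPow_eq (hβ : 1 < β) {x : ℝ} (hx : 0 ≤ x) (hxL : x ≤ L) : truncPow β L x = x ^ β := by
  have h : ∫ y in (0 : ℝ)..x, truncDeriv β L y = ∫ y in (0 : ℝ)..x, β * y ^ (β - 1) := by
    refine intervalIntegral.integral_congr fun y hy => ?_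
    rw [Set.uIcc_of_le hx] at hy
    simp only [truncDeriv]
    rw [max_eq_left hy.1, min_eq_left (hy.2.trans hxL)]
  rw [truncPow, primitive, h, intervalIntegral.integral_const_mul,
    integral_rpow (Or.inl (by linarith)), sub_add_cancel, Real.zero_rpow (by linarith), sub_zero]
  field_simp

theorem truncPow_of_ge (hβ : 1 < β) (hL : 0 < L) {x : ℝ} (hx : L ≤ x) :
    truncPow β L x = L ^ β + β * L ^ (β - 1) * (x - L) := by
  have hc := continuous_truncDeriv (L := L) hβ
  rw [← truncPow_eq hβ hL.le le_rfl, truncPow, primitive, primitive,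
    ← intervalIntegral.integral_add_adjacent_intervals (hc.intervalIntegrable 0 L)
      (hc.intervalIntegrable L x)]
  congr 1
  rw [intervalIntegral.integral_congr (g := fun _ => β * L ^ (β - 1)) fun y hy => ?_]
  · simp only [intervalIntegral.integral_const, smul_eq_mul]
    ring
  · rw [Set.uIcc_of_le hx] at hy
    simp only [truncDeriv]
    rw [max_eq_left (hL.le.trans hy.1), min_eq_right hy.1]

theorem truncPow_nonneg (hβ : 1 < β) (hL : 0 < L) (x : ℝ) : 0 ≤ truncPow β L x :=
  primitive_nonneg (truncDeriv_nonneg hβ hL) (fun _ => truncDeriv_of_nonpos hβ hL) x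

theorem mul_truncDeriv_le (hβ : 1 < β) (hL : 0 < L) {x : ℝ} (hx : 0 ≤ x) :
    x * truncDeriv β L x ≤ β * truncPow β L x := by
  rcases le_total x L with h | h
  · rw [truncPow_eq hβ hx h, truncDeriv, max_eq_left hx, min_eq_left h, mul_left_comm, mul_comm x,
      ← Real.rpow_add_one' hx (by linarith), sub_add_cancel]
  · rw [truncPow_of_ge hβ hL h, truncDeriv, max_eq_left hx, min_eq_right h]
    have h1 : L ^ β = L ^ (β - 1) * L := by
      rw [← Real.rpow_add_one' hL.le (by linarith), sub_add_cancel]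
    have h2 : 0 ≤ L ^ (β - 1) := Real.rpow_nonneg hL.le _
    rw [h1]
    have h3 : 0 ≤ β * (β - 1) * L ^ (β - 1) * (x - L) := by
      apply mul_nonneg (mul_nonneg (mul_nonneg _ _) h2) <;> linarith
    linarith

theorem truncPow_le (hβ : 1 < β) (hL : 0 < L) {x : ℝ} (hx : 0 ≤ x) : truncPow β L x ≤ x ^ β := by
  rw [← truncPow_eq (L := max x L) hβ hx (le_max_left _ _), truncPow, truncPow, primitive,
    primitive]
  refine intervalIntegral.integral_mono_on hx ((continuous_truncDeriv hβ).intervalIntegrable _ _)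
    ((continuous_truncDeriv hβ).intervalIntegrable _ _) fun y _ => ?_
  have h0 : 0 ≤ min (max y 0) L := le_min (le_max_right _ _) hL.le
  unfold truncDeriv
  gcongr
  exact le_max_right _ _

end Trunc

theorem primitive_le_mul {H : ℝ → ℝ} (hH : Continuous H) (hmono : Monotone H) {x : ℝ} (hx : 0 ≤ x) :
    primitive H x ≤ x * H x := by
  calc primitive H x ≤ ∫ _ in (0 : ℝ)..x, H x :=
        intervalIntegral.integral_mono_on hx (hH.intervalIntegrable _ _)
          (continuous_const.intervalIntegrable _ _) fun y hy => hmono hy.2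
    _ = x * H x := by simp

variable {k : ℕ} {Ω : Set (Space n)} {p s : ℝ} {φ : ℕ → Space n → ℝ} {V u : Space n → ℝ}
  {g : Space n → Space n}

/-! ### Energy estimates -/

namespace IsSolution

/-- The weak inequality for the test function `F(u)`, `F' = H` continuous and bounded. -/
theorem weak_comp (h : IsSolution k Ω p s φ V u g) {H : ℝ → ℝ} (hH : Continuous H)
    (hH0 : ∀ x, 0 ≤ H x) (hHneg : ∀ x ≤ 0, H x = 0) {M : ℝ} (hM : ∀ x, |H x| ≤ M) :
    ∫ z in Ω, ‖g z‖ ^ p * H (u z) ≤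
      ∫ z in Ω, V z * (|u z| ^ (p - 2) / xNorm k z ^ s) * u z * primitive H (u z) := by
  obtain ⟨K, hK, hK0, hKneg, hKM, hlim⟩ := exists_contDiff_tendsto hH hH0 hHneg hM
  have hM0 : 0 ≤ M + 2 := (abs_nonneg _).trans (hKM 0 0)
  have hprim (x : ℝ) : Tendsto (fun m => primitive (K m) x) atTop (𝓝 (primitive H x)) :=
    intervalIntegral.tendsto_integral_filter_of_dominated_convergence (fun _ => M + 2)
      (Eventually.of_forall fun m => (hK m).continuous.aestronglyMeasurable)
      (Eventually.of_forall fun m => ae_of_all _ fun y _ => hKM m y)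
      intervalIntegrable_const (ae_of_all _ fun y _ => hlim y)
  refine le_of_tendsto_of_tendsto' (b := atTop)
    (f := fun m => ∫ z in Ω, ‖g z‖ ^ p * K m (u z))
    (g := fun m => ∫ z in Ω, V z * (|u z| ^ (p - 2) / xNorm k z ^ s) * u z * primitive (K m) (u z))
    ?_ ?_ fun m => h.weak_comp_of_contDiff (hK m) (hK0 m) (hKneg m) (hKM m)
  · refine tendsto_integral_of_dominated_convergence (fun z => ‖g z‖ ^ p * (M + 2))
      (fun m => (integrable_norm_rpow_mul h.pos h.approx.memLp h.approx.meas (hK m).continuous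
        (hKM m)).1) ?_ (fun m => ae_of_all _ fun z => ?_) (ae_of_all _ fun z => ?_)
    · exact integrable_norm_rpow_mul h.pos h.approx.memLp h.approx.meas continuous_const
        (H := fun _ => M + 2) (M := |M + 2|) fun _ => le_rfl
    · rw [norm_mul, Real.norm_of_nonneg (by positivity)]
      gcongr
      exact hKM _ _
    · exact (hlim _).const_mul _
  · refine tendsto_integral_of_dominated_convergence
      (fun z => ‖V z * (|u z| ^ (p - 2) / xNorm k z ^ s) * u z * ((M + 2) * u z)‖)
      (fun m => h.aestronglyMeasurable_rhs ((continuous_primitive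
        (hK m).continuous).comp_aestronglyMeasurable h.approx.meas)) ?_
      (fun m => ae_of_all _ fun z => ?_) (ae_of_all _ fun z => (hprim _).const_mul _)
    · exact (h.integrable_rhs (F := fun x => (M + 2) * x) (by fun_prop) (M := M + 2)
        fun x => by rw [abs_mul, abs_of_nonneg hM0]).norm
    · rw [norm_mul, norm_mul _ ((M + 2) * u z)]
      gcongr
      rw [norm_mul, Real.norm_of_nonneg hM0]
      exact abs_primitive_le (hK m).continuous (hKM m) _

/-- The energy estimate (Caccioppoli inequality) for the truncated powers of `u`. -/
theorem energy_truncPow_le (h : IsSolution k Ω p s φ V u g) {β L : ℝ} (hβ : 1 < β) (hL : 0 < L) :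
    eLpNorm (fun z => truncDeriv β L (u z) • g z) (ENNReal.ofReal p) (volume.restrict Ω) ^ p ≤
      ENNReal.ofReal (β ^ p) *
        ∫⁻ z in Ω, ‖V z‖ₑ * ‖truncPow β L (u z)‖ₑ ^ p * weight k s z := by
  have hp0 := h.pos
  have hd0 := truncDeriv_nonneg hβ hL
  have hc := continuous_truncDeriv (L := L) hβ
  set H : ℝ → ℝ := fun x => truncDeriv β L x ^ p with hHdef
  have hH : Continuous H := hc.rpow_const fun _ => Or.inr hp0.le
  have hH0 (x : ℝ) : 0 ≤ H x := Real.rpow_nonneg (hd0 x) _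
  have hHneg : ∀ x ≤ 0, H x = 0 := fun x hx => by
    simp only [hHdef]
    rw [truncDeriv_of_nonpos hβ hL hx, Real.zero_rpow hp0.ne']
  have hHM (x : ℝ) : |H x| ≤ (β * L ^ (β - 1)) ^ p := by
    rw [abs_of_nonneg (hH0 x)]
    exact Real.rpow_le_rpow (hd0 x) (truncDeriv_le hβ hL x) hp0.le
  have hHmono : Monotone H := fun x y hxy =>
    Real.rpow_le_rpow (hd0 x) (truncDeriv_mono hβ hL hxy) hp0.le
  calc eLpNorm (fun z => truncDeriv β L (u z) • g z) (ENNReal.ofReal p) (volume.restrict Ω) ^ p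
      = ∫⁻ z in Ω, ENNReal.ofReal (‖g z‖ ^ p * H (u z)) := by
        rw [eLpNorm_ofReal_rpow hp0]
        refine lintegral_congr fun z => ?_
        rw [← ofReal_norm, ENNReal.ofReal_rpow_of_nonneg (norm_nonneg _) hp0.le, norm_smul,
          Real.mul_rpow (norm_nonneg _) (norm_nonneg _), Real.norm_of_nonneg (hd0 _), mul_comm]
    _ = ENNReal.ofReal (∫ z in Ω, ‖g z‖ ^ p * H (u z)) := by
        rw [ofReal_integral_eq_lintegral_ofReal
          (integrable_norm_rpow_mul hp0 h.approx.memLp h.approx.meas hH hHM)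
          (ae_of_all _ fun z => mul_nonneg (by positivity) (hH0 _))]
    _ ≤ ENNReal.ofReal (∫ z in Ω, V z * (|u z| ^ (p - 2) / xNorm k z ^ s) * u z *
          primitive H (u z)) := ENNReal.ofReal_le_ofReal (h.weak_comp hH hH0 hHneg hHM)
    _ ≤ ∫⁻ z in Ω, ‖V z‖ₑ * ‖u z‖ₑ ^ (p - 1) * weight k s z * ‖primitive H (u z)‖ₑ := by
        refine (Real.ofReal_le_enorm _).trans ((enorm_integral_le_lintegral_enorm _).trans_eq ?_)
        exact lintegral_congr fun z => enorm_rhs h.one_lt _ _ _ _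
    _ ≤ ∫⁻ z in Ω, ENNReal.ofReal (β ^ p) *
          (‖V z‖ₑ * ‖truncPow β L (u z)‖ₑ ^ p * weight k s z) := by
        refine lintegral_mono_ae (h.nonneg.mono fun z hz => ?_)
        have key : ‖u z‖ₑ ^ (p - 1) * ‖primitive H (u z)‖ₑ ≤
            ENNReal.ofReal (β ^ p) * ‖truncPow β L (u z)‖ₑ ^ p := by
          have hT := truncPow_nonneg hβ hL (u z)
          have h1 : 0 ≤ p - 1 := by linarith [h.one_lt]
          rw [Real.enorm_of_nonneg hz, Real.enorm_of_nonneg hT,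
            Real.enorm_of_nonneg (primitive_nonneg hH0 hHneg _),
            ENNReal.ofReal_rpow_of_nonneg hz h1, ENNReal.ofReal_rpow_of_nonneg hT hp0.le,
            ← ENNReal.ofReal_mul (by positivity), ← ENNReal.ofReal_mul (by positivity)]
          refine ENNReal.ofReal_le_ofReal ?_
          calc u z ^ (p - 1) * primitive H (u z) ≤ u z ^ (p - 1) * (u z * H (u z)) := by
                gcongr
                exact primitive_le_mul hH hHmono hz
            _ = (u z * truncDeriv β L (u z)) ^ p := by
                rw [Real.mul_rpow hz (hd0 _), ← mul_assoc,
                  ← Real.rpow_add_one' hz (by linarith), sub_add_cancel]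
            _ ≤ (β * truncPow β L (u z)) ^ p :=
                Real.rpow_le_rpow (mul_nonneg hz (hd0 _)) (mul_truncDeriv_le hβ hL hz) hp0.le
            _ = β ^ p * truncPow β L (u z) ^ p := Real.mul_rpow (by linarith) hT
        calc _ = (‖u z‖ₑ ^ (p - 1) * ‖primitive H (u z)‖ₑ) * (‖V z‖ₑ * weight k s z) := by ring
          _ ≤ (ENNReal.ofReal (β ^ p) * ‖truncPow β L (u z)‖ₑ ^ p) *
              (‖V z‖ₑ * weight k s z) := by gcongr
          _ = _ := by ring
    _ = _ := lintegral_const_mul' _ _ ENNReal.ofReal_ne_top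

/-- The Hardy-Sobolev inequality combined with the energy estimate. -/
theorem lintegral_truncPow_le (h : IsSolution k Ω p s φ V u g) {t : ℝ} (htk : t < min p k)
    {C : ℝ≥0∞} (hC : C ≠ ⊤) (hCb : HardySobolevBound k Ω p t C)
    {β L : ℝ} (hβ : 1 < β) (hL : 0 < L) :
    ∫⁻ z in Ω, ‖truncPow β L (u z)‖ₑ ^ pStar n p t * weight k t z ≤
      C * (ENNReal.ofReal (β ^ p) *
        ∫⁻ z in Ω, ‖V z‖ₑ * ‖truncPow β L (u z)‖ₑ ^ p * weight k s z) ^ (pStar n p t / p) := by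
  have hp0 := h.pos
  have hq := pStar_pos hp0 h.lt_dim (htk.le.trans (min_le_left _ _))
  refine (h.approx.hardySobolev_comp h.one_lt.le hCb hC hq
    (hasDerivAt_primitive (continuous_truncDeriv hβ)) (continuous_truncDeriv hβ) (primitive_zero _)
    (abs_truncDeriv_le hβ hL)).trans ?_
  gcongr
  calc _ = (eLpNorm (fun z => truncDeriv β L (u z) • g z) (ENNReal.ofReal p)
        (volume.restrict Ω) ^ p) ^ (pStar n p t / p) := by
        rw [← ENNReal.rpow_mul, mul_div_cancel₀ _ hp0.ne']
    _ ≤ _ := ENNReal.rpow_le_rpow (h.energy_truncPow_le hβ hL) (by positivity)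

/-- Passage to the limit in `lintegral_truncPow_le` as the truncation is removed. -/
theorem lintegral_rpow_le (h : IsSolution k Ω p s φ V u g) {t : ℝ} (htk : t < min p k)
    {C : ℝ≥0∞} (hC : C ≠ ⊤) (hCb : HardySobolevBound k Ω p t C) {β : ℝ} (hβ : 1 < β) {B : ℝ≥0∞}
    (hB : ∀ L : ℝ, 0 < L →
      ∫⁻ z in Ω, ‖V z‖ₑ * ‖truncPow β L (u z)‖ₑ ^ p * weight k s z ≤ B) :
    ∫⁻ z in Ω, ‖u z‖ₑ ^ (β * pStar n p t) * weight k t z ≤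
      C * (ENNReal.ofReal (β ^ p) * B) ^ (pStar n p t / p) := by
  have hp0 := h.pos
  have hq := pStar_pos hp0 h.lt_dim (htk.le.trans (min_le_left _ _))
  have hm (j : ℕ) : AEMeasurable (fun z => ‖truncPow β ((j : ℝ) + 1) (u z)‖ₑ ^ pStar n p t *
      weight k t z) (volume.restrict Ω) :=
    (((continuous_primitive (continuous_truncDeriv hβ)).comp_aestronglyMeasurable
      h.approx.meas).enorm.pow_const _).mul (measurable_weight k t).aemeasurable
  calc ∫⁻ z in Ω, ‖u z‖ₑ ^ (β * pStar n p t) * weight k t z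
      ≤ ∫⁻ z in Ω, liminf (fun j : ℕ => ‖truncPow β ((j : ℝ) + 1) (u z)‖ₑ ^ pStar n p t *
          weight k t z) atTop := by
        refine lintegral_mono_ae (h.nonneg.mono fun z hz => le_of_eq ?_)
        refine (Tendsto.liminf_eq (tendsto_const_nhds.congr' ?_)).symm
        obtain ⟨N, hN⟩ := exists_nat_ge (u z)
        filter_upwards [eventually_ge_atTop N] with j hj
        have hj' : u z ≤ (j : ℝ) + 1 := by
          have : (N : ℝ) ≤ j := by exact_mod_cast hj
          linarith
        rw [truncPow_eq hβ hz hj', Real.enorm_rpow_of_nonneg hz (by linarith), ← ENNReal.rpow_mul]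
    _ ≤ liminf (fun j : ℕ => ∫⁻ z in Ω, ‖truncPow β ((j : ℝ) + 1) (u z)‖ₑ ^ pStar n p t *
          weight k t z) atTop := lintegral_liminf_le' hm
    _ ≤ C * (ENNReal.ofReal (β ^ p) * B) ^ (pStar n p t / p) :=
        liminf_le_of_le (by isBoundedDefault) fun b hb => by
          obtain ⟨j, hj⟩ := hb.exists
          refine hj.trans ((h.lintegral_truncPow_le htk hC hCb hβ (by positivity)).trans ?_)
          gcongr
          exact hB _ (by positivity)

end IsSolution

end

section

variable {n : ℕ} {k : ℕ} {Ω : Set (Space n)} {p s : ℝ} {φ : ℕ → Space n → ℝ} {V u : Space n → ℝ}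
  {g : Space n → Space n}

/-! ### Integrability of every power -/

/-- The part of an `L^ρ` function above the level `K` tends to `0` in `L^ρ`. -/
theorem tendsto_lintegral_sub_rpow {α : Type*} [MeasurableSpace α] {μ : Measure α} {ρ : ℝ}
    (hρ : 0 < ρ) {f : α → ℝ≥0∞} (hf : AEMeasurable f μ) (hfin : ∫⁻ z, f z ^ ρ ∂μ ≠ ⊤) :
    Tendsto (fun K : ℕ => ∫⁻ z, (f z - K) ^ ρ ∂μ) atTop (𝓝 0) := by
  have h := tendsto_lintegral_of_dominated_convergence' (μ := μ) (f := fun _ => 0)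
    (F := fun (K : ℕ) z => (f z - K) ^ ρ) (fun z => f z ^ ρ)
    (fun K => (hf.sub_const _).pow_const _) (fun K => ae_of_all _ fun z => by
      simp only
      gcongr
      exact tsub_le_self) hfin ?_
  · simpa using h
  · filter_upwards [ae_lt_top' (hf.pow_const ρ) hfin] with z hz
    have hz' : f z < ⊤ := by
      by_contra hc
      rw [not_lt_top_iff] at hc
      simp [hc, hρ] at hz
    obtain ⟨N, hN⟩ := ENNReal.exists_nat_gt hz'.ne
    refine tendsto_const_nhds.congr' ?_
    filter_upwards [eventually_ge_atTop N] with K hK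
    rw [tsub_eq_zero_of_le (hN.le.trans (by exact_mod_cast hK)), ENNReal.zero_rpow_of_pos hρ]

theorem le_two_mul_of_le_add_half {J A c : ℝ≥0∞} (hJ : J ≠ ⊤) (hc : c ≤ 1 / 2)
    (h : J ≤ A + c * J) : J ≤ 2 * A := by
  have h1 : J / 2 + J / 2 ≤ A + J / 2 := by
    rw [ENNReal.add_halves]
    refine h.trans ?_
    gcongr
    rw [div_eq_mul_inv, mul_comm, ← one_div]
    gcongr
  have h2 : J / 2 ≤ A := ENNReal.le_of_add_le_add_right
    (ENNReal.div_ne_top hJ (by norm_num)) h1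
  rwa [ENNReal.div_le_iff (by norm_num) (by norm_num), mul_comm] at h2

theorem rpow_le_add {x : ℝ≥0∞} {a q b : ℝ} (haq : a ≤ q) (hqb : q ≤ b) :
    x ^ q ≤ x ^ a + x ^ b := by
  rcases le_total x 1 with h | h
  · exact (ENNReal.rpow_le_rpow_of_exponent_ge h haq).trans le_self_add
  · exact (ENNReal.rpow_le_rpow_of_exponent_le h hqb).trans le_add_self

namespace IsSolution

theorem enorm_truncPow_le (h : IsSolution k Ω p s φ V u g) {β L : ℝ} (hβ : 1 < β) (hL : 0 < L) :
    ∀ᵐ z ∂volume.restrict Ω, ‖truncPow β L (u z)‖ₑ ≤ ‖u z‖ₑ ^ β := by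
  filter_upwards [h.nonneg] with z hz
  rw [← Real.enorm_rpow_of_nonneg hz (by linarith),
    Real.enorm_of_nonneg (truncPow_nonneg hβ hL _), Real.enorm_of_nonneg (Real.rpow_nonneg hz _)]
  exact ENNReal.ofReal_le_ofReal (truncPow_le hβ hL hz)

theorem aemeasurable_truncPow (h : IsSolution k Ω p s φ V u g) {β L : ℝ} (hβ : 1 < β) :
    AEMeasurable (fun z => ‖truncPow β L (u z)‖ₑ) (volume.restrict Ω) :=
  ((continuous_primitive (continuous_truncDeriv hβ)).comp_aestronglyMeasurable
    h.approx.meas).enorm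

theorem lintegral_potential_truncPow_lt_top (h : IsSolution k Ω p s φ V u g) {β L : ℝ}
    (hβ : 1 < β) (hL : 0 < L) :
    ∫⁻ z in Ω, ‖V z‖ₑ * ‖truncPow β L (u z)‖ₑ ^ p * weight k s z < ⊤ := by
  have hρ := rPrime_pos h.pos h.lt_dim h.s_lt
  have hd := h.dual_pos
  have hpd := mul_pos h.pos hd
  refine (lintegral_mul_rpow_weight_le h.one_lt.le hρ hd
    (inv_rPrime_add_inv_dualExp h.pos h.lt_dim) h.memLp_V.1.enorm
    (h.aemeasurable_truncPow hβ)).trans_lt (ENNReal.mul_lt_top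
    (ENNReal.rpow_lt_top_of_nonneg (by positivity) (lintegral_enorm_rpow_lt_top hρ h.memLp_V).ne)
    (ENNReal.rpow_lt_top_of_nonneg (by positivity) (ne_of_lt ?_)))
  refine lt_of_le_of_lt (lintegral_mono fun z => ?_) ((lintegral_const_mul' _ _
    (ENNReal.rpow_ne_top_of_nonneg hpd.le (ENNReal.ofReal_ne_top (r := β * L ^ (β - 1))))).trans_lt
    (ENNReal.mul_lt_top (ENNReal.rpow_lt_top_of_nonneg hpd.le ENNReal.ofReal_ne_top)
      h.lintegral_dual_lt_top))
  rw [← mul_assoc, ← ENNReal.mul_rpow_of_nonneg _ _ hpd.le]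
  gcongr
  rw [← ofReal_norm, ← ofReal_norm (u z), ← ENNReal.ofReal_mul' (norm_nonneg _)]
  exact ENNReal.ofReal_le_ofReal
    (abs_primitive_le (continuous_truncDeriv hβ) (abs_truncDeriv_le hβ hL) _)

/-- If `u^β ∈ L^p(|x|^{-s})`, then the energies of the truncated powers are bounded independently
of the truncation: the part of `V` above a high level has small norm in `L^{r'}`, and its
contribution is absorbed. -/
theorem exists_potential_le (h : IsSolution k Ω p s φ V u g) {β : ℝ} (hβ : 1 < β)
    (hA : ∫⁻ z in Ω, ‖u z‖ₑ ^ (β * p) * weight k s z < ⊤) :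
    ∃ B : ℝ≥0∞, B ≠ ⊤ ∧ ∀ L : ℝ, 0 < L →
      ∫⁻ z in Ω, ‖V z‖ₑ * ‖truncPow β L (u z)‖ₑ ^ p * weight k s z ≤ B := by
  have hp0 := h.pos
  have hρ := rPrime_pos h.pos h.lt_dim h.s_lt
  set ρ := rPrime n p s
  have hd := h.dual_pos
  set d := dualExp n p s with hddef
  obtain ⟨C, hC, hCb⟩ := h.hardySobolev _ (mul_nonneg h.s_nonneg h.dual_pos.le) h.dual_lt
  have hVm : AEMeasurable (fun z => ‖V z‖ₑ) (volume.restrict Ω) := h.memLp_V.1.enorm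
  have htail : Tendsto (fun K : ℕ => (∫⁻ z in Ω, (‖V z‖ₑ - K) ^ ρ) ^ (1 / ρ) *
      (C ^ (1 / d) * ENNReal.ofReal (β ^ p))) atTop (𝓝 0) := by
    have h1 := ENNReal.Tendsto.mul_const (b := C ^ (1 / d) * ENNReal.ofReal (β ^ p))
      ((tendsto_lintegral_sub_rpow hρ hVm
        (lintegral_enorm_rpow_lt_top hρ h.memLp_V).ne).ennrpow_const (1 / ρ))
      (Or.inr (ENNReal.mul_ne_top (ENNReal.rpow_ne_top_of_nonneg (by positivity) hC)
        ENNReal.ofReal_ne_top))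
    rwa [ENNReal.zero_rpow_of_pos (by positivity), zero_mul] at h1
  obtain ⟨K, hK⟩ := (htail.eventually (ge_mem_nhds (show (0 : ℝ≥0∞) < 1 / 2 by norm_num))).exists
  -- `K` is chosen so that the contribution of `(|V| - K)⁺` is at most half of the energy
  refine ⟨2 * (K * ∫⁻ z in Ω, ‖u z‖ₑ ^ (β * p) * weight k s z), ENNReal.mul_ne_top (by norm_num)
    (ENNReal.mul_ne_top (by simp) hA.ne), fun L hL => ?_⟩
  have hGm := h.aemeasurable_truncPow (L := L) hβ
  have hfin := h.lintegral_potential_truncPow_lt_top hβ hL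
  set J := ∫⁻ z in Ω, ‖V z‖ₑ * ‖truncPow β L (u z)‖ₑ ^ p * weight k s z
  refine le_two_mul_of_le_add_half hfin.ne hK ?_
  have hlow : ∫⁻ z in Ω, K * (‖truncPow β L (u z)‖ₑ ^ p * weight k s z) ≤
      K * ∫⁻ z in Ω, ‖u z‖ₑ ^ (β * p) * weight k s z := by
    rw [lintegral_const_mul' _ _ (by simp)]
    refine mul_le_mul_right (lintegral_mono_ae ((h.enorm_truncPow_le hβ hL).mono fun z hz => ?_)) _
    rw [ENNReal.rpow_mul]
    gcongr
  have hhigh : ∫⁻ z in Ω, (‖V z‖ₑ - K) * ‖truncPow β L (u z)‖ₑ ^ p * weight k s z ≤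
      (∫⁻ z in Ω, (‖V z‖ₑ - K) ^ ρ) ^ (1 / ρ) * (C ^ (1 / d) * ENNReal.ofReal (β ^ p)) * J := by
    refine (lintegral_mul_rpow_weight_le h.one_lt.le hρ hd
      (inv_rPrime_add_inv_dualExp h.pos h.lt_dim) (hVm.sub_const _) hGm).trans ?_
    rw [mul_assoc]
    gcongr
    have h1 := h.lintegral_truncPow_le h.dual_lt hC hCb hβ hL
    rw [pStar_mul_dualExp h.lt_dim h.s_nonneg, mul_div_cancel_left₀ _ hp0.ne'] at h1
    refine (ENNReal.rpow_le_rpow h1 (by positivity)).trans_eq ?_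
    rw [ENNReal.mul_rpow_of_nonneg _ _ (by positivity), ← ENNReal.rpow_mul,
      mul_one_div_cancel hd.ne', ENNReal.rpow_one, mul_assoc]
  calc J ≤ ∫⁻ z in Ω, (K * (‖truncPow β L (u z)‖ₑ ^ p * weight k s z) +
        (‖V z‖ₑ - K) * ‖truncPow β L (u z)‖ₑ ^ p * weight k s z) := by
        refine lintegral_mono fun z => ?_
        simp only
        rw [← mul_assoc, ← add_mul, ← add_mul]
        gcongr
        exact le_add_tsub
    _ = (∫⁻ z in Ω, K * (‖truncPow β L (u z)‖ₑ ^ p * weight k s z)) +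
        ∫⁻ z in Ω, (‖V z‖ₑ - K) * ‖truncPow β L (u z)‖ₑ ^ p * weight k s z :=
        lintegral_add_left' (((hGm.pow_const _).mul (measurable_weight k s).aemeasurable).const_mul
          _) _
    _ ≤ _ := add_le_add hlow hhigh

theorem s_lt_min (h : IsSolution k Ω p s φ V u g) : s < min p k := by
  refine lt_of_le_of_lt (le_mul_of_one_le_right h.s_nonneg ?_) h.dual_lt
  have := h.lt_dim
  have := h.s_nonneg
  have := h.s_lt
  rw [dualExp, one_le_div (by linarith)]
  linarith

/-- The exponent of integrability can be multiplied by `p*(s)/p > 1` again and again. -/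
theorem lintegral_pow_lt_top (h : IsSolution k Ω p s φ V u g) (m : ℕ) :
    ∀ t : ℝ, 0 ≤ t → t < min p k →
      ∫⁻ z in Ω, ‖u z‖ₑ ^ ((pStar n p s / p) ^ m * pStar n p t) * weight k t z < ⊤ := by
  have hp0 := h.pos
  have hβ : 1 < pStar n p s / p := (one_lt_div hp0).2 (pStar_gt_self hp0 h.lt_dim h.s_lt)
  induction m with
  | zero => intro t ht htk; simpa using h.lintegral_lt_top ht htk
  | succ m ih =>
    intro t ht htk
    have hβm : 1 < (pStar n p s / p) ^ (m + 1) := one_lt_pow₀ hβ (by omega)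
    have hA : ∫⁻ z in Ω, ‖u z‖ₑ ^ ((pStar n p s / p) ^ (m + 1) * p) * weight k s z < ⊤ := by
      have := ih s h.s_nonneg h.s_lt_min
      rwa [show (pStar n p s / p) ^ (m + 1) * p = (pStar n p s / p) ^ m * pStar n p s by
        rw [pow_succ, mul_assoc, div_mul_cancel₀ _ hp0.ne']]
    obtain ⟨B, hB, hBL⟩ := h.exists_potential_le hβm hA
    obtain ⟨C, hC, hCb⟩ := h.hardySobolev t ht htk
    refine (h.lintegral_rpow_le htk hC hCb hβm hBL).trans_lt (ENNReal.mul_lt_top hC.lt_top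
      (ENNReal.rpow_lt_top_of_nonneg ?_ (ENNReal.mul_ne_top ENNReal.ofReal_ne_top hB)))
    exact div_nonneg (pStar_pos hp0 h.lt_dim (htk.le.trans (min_le_left _ _))).le hp0.le

theorem lintegral_rpow_lt_top (h : IsSolution k Ω p s φ V u g) {t q : ℝ} (ht : 0 ≤ t)
    (htk : t < min p k) (hq : pStar n p t ≤ q) :
    ∫⁻ z in Ω, ‖u z‖ₑ ^ q * weight k t z < ⊤ := by
  have hp0 := h.pos
  have hβ : 1 < pStar n p s / p := (one_lt_div hp0).2 (pStar_gt_self hp0 h.lt_dim h.s_lt)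
  have hq0 := pStar_pos hp0 h.lt_dim (htk.le.trans (min_le_left _ _))
  obtain ⟨m, hm⟩ := pow_unbounded_of_one_lt (q / pStar n p t) hβ
  rw [div_lt_iff₀ hq0] at hm
  refine lt_of_le_of_lt (lintegral_mono fun z => ?_) ((lintegral_add_left'
    ((h.approx.meas.enorm.pow_const _).mul (measurable_weight k t).aemeasurable) _).trans_lt
    (ENNReal.add_lt_top.2 ⟨h.lintegral_lt_top ht htk, h.lintegral_pow_lt_top m t ht htk⟩))
  simp only [Pi.mul_apply]
  rw [← add_mul]
  gcongr
  exact rpow_le_add hq hm.le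

theorem memLp_weighted (h : IsSolution k Ω p s φ V u g) {t q : ℝ} (ht : 0 ≤ t)
    (htk : t < min p k) (hq : pStar n p t ≤ q) :
    MemLp u (ENNReal.ofReal q) (weighted k Ω t) := by
  have hq0 : 0 < q := (pStar_pos h.pos h.lt_dim (htk.le.trans (min_le_left _ _))).trans_le hq
  refine ⟨h.approx.meas.mono_ac (withDensity_absolutelyContinuous _ _), ?_⟩
  rw [eLpNorm_ofReal hq0]
  refine ENNReal.rpow_lt_top_of_nonneg (by positivity) (ne_of_lt ?_)
  show ∫⁻ z, ‖u z‖ₑ ^ q ∂(volume.restrict Ω).withDensity (weight k t) < ⊤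
  rw [lintegral_withDensity_eq_lintegral_mul₀ (measurable_weight k t).aemeasurable
    (h.approx.meas.enorm.pow_const _)]
  simpa [mul_comm] using h.lintegral_rpow_lt_top ht htk hq

end IsSolution

/-! ### Boundedness -/

theorem volume_xNorm_eq_zero (hk : 0 < k) (hkn : k ≤ n) :
    volume {z : Space n | xNorm k z = 0} = 0 := by
  have hn : 0 < n := hk.trans_le hkn
  set i : Fin n := ⟨0, hn⟩
  refine measure_mono_null (t := ((LinearMap.ker (EuclideanSpace.proj i : Space n →L[ℝ] ℝ).toLinearMap
    : Submodule ℝ (Space n)) : Set (Space n))) (fun z hz => ?_) (Measure.addHaar_submodule _ _ ?_)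
  · have h1 : xNorm k z ^ 2 = 0 := by rw [show xNorm k z = 0 from hz]; simp
    rw [xNorm_sq, Finset.sum_eq_zero_iff_of_nonneg fun _ _ => sq_nonneg _] at h1
    have := h1 i (by simp [i, hk])
    simpa using this
  · intro htop
    have h1 : EuclideanSpace.single i (1 : ℝ) ∈
        LinearMap.ker (EuclideanSpace.proj i : Space n →L[ℝ] ℝ).toLinearMap := by
      rw [htop]; trivial
    simp at h1

/-- A sequence with `N_{m+1} ≤ (D R^m)^{χ^{-m}} N_m`, `χ > 1`, is bounded. -/
theorem exists_bound_of_moser {N : ℕ → ℝ≥0∞} {D R : ℝ≥0∞} {χ : ℝ} (hχ : 1 < χ) (hD : 1 ≤ D)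
    (hR : 1 ≤ R) (hDt : D ≠ ⊤) (hRt : R ≠ ⊤) (h0 : N 0 ≠ ⊤)
    (h : ∀ m : ℕ, N (m + 1) ≤ (D * R ^ m) ^ (χ⁻¹ ^ m) * N m) :
    ∃ B : ℝ≥0∞, B ≠ ⊤ ∧ ∀ m, N m ≤ B := by
  have hχ0 : 0 < χ⁻¹ := by positivity
  have hs1 : Summable fun m : ℕ => χ⁻¹ ^ m :=
    summable_geometric_of_lt_one hχ0.le (inv_lt_one_of_one_lt₀ hχ)
  have hs2 : Summable fun m : ℕ => (m : ℝ) * χ⁻¹ ^ m := by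
    simpa using summable_pow_mul_geometric_of_norm_lt_one 1 (r := χ⁻¹)
      (by rw [Real.norm_of_nonneg hχ0.le]; exact inv_lt_one_of_one_lt₀ hχ)
  have key (m : ℕ) : N m ≤ D ^ (∑ j ∈ Finset.range m, χ⁻¹ ^ j) *
      R ^ (∑ j ∈ Finset.range m, (j : ℝ) * χ⁻¹ ^ j) * N 0 := by
    induction m with
    | zero => simp
    | succ m ih =>
      refine (h m).trans ((mul_le_mul_right ih _).trans_eq ?_)
      rw [Finset.sum_range_succ, Finset.sum_range_succ,
        ENNReal.rpow_add_of_nonneg _ _ (by positivity) (by positivity),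
        ENNReal.rpow_add_of_nonneg _ _ (Finset.sum_nonneg fun _ _ => by positivity)
          (by positivity), ENNReal.mul_rpow_of_nonneg _ _ (by positivity), ← ENNReal.rpow_natCast R,
        ← ENNReal.rpow_mul R]
      ring
  refine ⟨D ^ (∑' j : ℕ, χ⁻¹ ^ j) * R ^ (∑' j : ℕ, (j : ℝ) * χ⁻¹ ^ j) * N 0,
    ENNReal.mul_ne_top (ENNReal.mul_ne_top (ENNReal.rpow_ne_top_of_nonneg (tsum_nonneg fun _ => by
      positivity) hDt) (ENNReal.rpow_ne_top_of_nonneg (tsum_nonneg fun _ => by positivity) hRt)) h0,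
    fun m => (key m).trans ?_⟩
  gcongr
  · exact hs1.sum_le_tsum _ fun _ _ => by positivity
  · exact hs2.sum_le_tsum _ fun _ _ => by positivity

/-- If `∫ f^γ w ≤ b^γ` for arbitrarily large `γ`, then `f < 2 b + 1` almost everywhere on
`{w ≠ 0}`. -/
theorem ae_lt_of_lintegral_rpow_le {α : Type*} [MeasurableSpace α] {μ : Measure α}
    {f w : α → ℝ≥0∞} (hf : AEMeasurable f μ) (hw : AEMeasurable w μ)
    {b : ℝ≥0∞} (hb : b ≠ ⊤) {γ : ℕ → ℝ} (hγ : Tendsto γ atTop atTop)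
    (h : ∀ m, ∫⁻ z, f z ^ γ m * w z ∂μ ≤ b ^ γ m) (hw0 : ∀ᵐ z ∂μ, w z ≠ 0) :
    ∀ᵐ z ∂μ, f z < 2 * b + 1 := by
  set c := 2 * b + 1 with hc
  have hctop : c ≠ ⊤ := ENNReal.add_ne_top.2 ⟨ENNReal.mul_ne_top (by norm_num) hb, by norm_num⟩
  have hc0 : c ≠ 0 := by simp [hc]
  set ν := μ.withDensity w
  have hfν : AEMeasurable f ν := hf.mono_ac (withDensity_absolutelyContinuous _ _)
  have hbc : b / c ≤ 1 / 2 := by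
    rw [ENNReal.div_le_iff hc0 hctop, hc, mul_add, ← mul_assoc, one_div,
      ENNReal.inv_mul_cancel (by norm_num) (by norm_num), one_mul]
    exact le_self_add
  have hν (j : ℕ) : ν {z | c ≤ f z} ≤ (1 / 2 : ℝ≥0∞) ^ j := by
    obtain ⟨m, hm⟩ := (hγ.eventually_ge_atTop ((j : ℝ) + 1)).exists
    have hγ0 : 0 < γ m := by
      have : (0 : ℝ) ≤ j := Nat.cast_nonneg j
      linarith
    have h1 : c ^ γ m * ν {z | c ≤ f z} ≤ b ^ γ m := by
      have h2 := mul_meas_ge_le_lintegral₀ (hfν.pow_const (γ m)) (c ^ γ m)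
      have h3 : {z | c ^ γ m ≤ f z ^ γ m} = {z | c ≤ f z} := by
        ext z
        exact ENNReal.rpow_le_rpow_iff hγ0
      rw [h3] at h2
      refine h2.trans (le_trans (le_of_eq ?_) (h m))
      rw [lintegral_withDensity_eq_lintegral_mul₀ hw (hf.pow_const _)]
      simp [mul_comm]
    calc ν {z | c ≤ f z} ≤ b ^ γ m / c ^ γ m := by
          rw [ENNReal.le_div_iff_mul_le (Or.inl (ENNReal.rpow_pos (pos_iff_ne_zero.2 hc0)
            hctop).ne') (Or.inl (ENNReal.rpow_ne_top_of_nonneg hγ0.le hctop)), mul_comm]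
          exact h1
      _ = (b / c) ^ γ m := (ENNReal.div_rpow_of_nonneg _ _ hγ0.le).symm
      _ ≤ (1 / 2) ^ γ m := by gcongr
      _ ≤ (1 / 2) ^ (j : ℝ) := ENNReal.rpow_le_rpow_of_exponent_ge (by norm_num) (by linarith)
      _ = _ := ENNReal.rpow_natCast _ _
  have hν0 : ν {z | c ≤ f z} = 0 := by
    refine le_antisymm (ge_of_tendsto' (ENNReal.tendsto_pow_atTop_nhds_zero_of_lt_one ?_) hν) zero_le
    norm_num
  have h4 : ∀ᵐ z ∂ν, f z < c := by
    rw [ae_iff]; simpa using hν0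
  rw [ae_withDensity_iff' hw] at h4
  filter_upwards [h4, hw0] with z h5 h6 using h5 h6

namespace IsSolution

/-- One step of Moser's iteration. -/
theorem lintegral_moser_le (h : IsSolution k Ω p s φ V u g) {a d : ℝ} (ha : 0 < a) (hd : 0 < d)
    (had : 1 / a + 1 / d = 1) (hsd : s * d < min p k) {C : ℝ≥0∞} (hC : C ≠ ⊤)
    (hCb : HardySobolevBound k Ω p (s * d) C) {β : ℝ} (hβ : 1 < β) :
    ∫⁻ z in Ω, ‖u z‖ₑ ^ (β * pStar n p (s * d)) * weight k (s * d) z ≤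
      C * (ENNReal.ofReal (β ^ p) * ((∫⁻ z in Ω, ‖V z‖ₑ ^ a) ^ (1 / a) *
        (∫⁻ z in Ω, ‖u z‖ₑ ^ (β * (p * d)) * weight k (s * d) z) ^ (1 / d))) ^
          (pStar n p (s * d) / p) := by
  have hp0 := h.pos
  refine h.lintegral_rpow_le hsd hC hCb hβ fun L hL => ?_
  refine (lintegral_mul_rpow_weight_le h.one_lt.le ha hd had h.memLp_V.1.enorm
    (h.aemeasurable_truncPow hβ)).trans ?_
  refine mul_le_mul_right (ENNReal.rpow_le_rpow (lintegral_mono_ae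
    ((h.enorm_truncPow_le hβ hL).mono fun z hz => ?_)) (by positivity)) _
  rw [ENNReal.rpow_mul _ β]
  gcongr

theorem memLp_top (h : IsSolution k Ω p s φ V u g) (hk : 0 < k) (hkn : k ≤ n) {a : ℝ}
    (ha : rPrime n p s < a) (hVa : ∫⁻ z in Ω, ‖V z‖ₑ ^ a < ⊤) :
    MemLp u ⊤ (volume.restrict Ω) := by
  have hp0 := h.pos
  have hnp : 0 < n - p := by linarith [h.lt_dim]
  have hs0 := h.s_nonneg
  have hρ := rPrime_pos h.pos h.lt_dim h.s_lt
  have ha0 : 0 < a := hρ.trans ha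
  have hconj := inv_rPrime_add_inv_dualExp (s := s) h.pos h.lt_dim
  have hdual := h.dual_pos
  have hinv : 1 / a < 1 / rPrime n p s := one_div_lt_one_div_of_lt hρ ha
  have hdi : 1 / dualExp n p s < 1 - 1 / a := by linarith
  have hdi0 : 0 < 1 - 1 / a := (by positivity : 0 < 1 / dualExp n p s).trans hdi
  set d : ℝ := 1 / (1 - 1 / a) with hd
  have hd0 : 0 < d := by positivity
  have had : 1 / a + 1 / d = 1 := by rw [hd, one_div_one_div]; ring
  have hdlt : d < dualExp n p s := by
    rw [hd]; exact (one_div_lt hdi0 hdual).2 hdi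
  have hsd : s * d < min p k := (mul_le_mul_of_nonneg_left hdlt.le hs0).trans_lt h.dual_lt
  have hsd0 : 0 ≤ s * d := mul_nonneg hs0 hd0.le
  have hpd : 0 < p * d := mul_pos hp0 hd0
  -- the gain of integrability in one step; `χ > 1` amounts to `d < n / (n - p + s)`
  set χ : ℝ := pStar n p (s * d) / (p * d) with hχdef
  have hχ : 1 < χ := by
    rw [dualExp, lt_div_iff₀ (by linarith)] at hdlt
    rw [hχdef, one_lt_div hpd, pStar, lt_div_iff₀ hnp]
    nlinarith
  have hχ0 : 0 < χ := by linarith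
  have hq : pStar n p (s * d) = χ * (p * d) := by rw [hχdef, div_mul_cancel₀ _ hpd.ne']
  obtain ⟨C, hC, hCb⟩ := h.hardySobolev _ hsd0 hsd
  set W := (∫⁻ z in Ω, ‖V z‖ₑ ^ a) ^ (1 / a) with hW
  have hWt : W ≠ ⊤ := ENNReal.rpow_ne_top_of_nonneg (by positivity) hVa.ne
  set A : ℕ → ℝ≥0∞ := fun m =>
    ∫⁻ z in Ω, ‖u z‖ₑ ^ (χ ^ (m + 1) * (p * d)) * weight k (s * d) z with hAdef
  have hstep (m : ℕ) : A (m + 1) ≤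
      C * (ENNReal.ofReal ((χ ^ (m + 1)) ^ p) * (W * A m ^ (1 / d))) ^ (χ * d) := by
    have := h.lintegral_moser_le ha0 hd0 had hsd hC hCb (one_lt_pow₀ hχ (Nat.succ_ne_zero m))
    rw [hq] at this
    rw [show χ * d = χ * (p * d) / p by field_simp]
    convert this using 5
    rw [Nat.succ_eq_add_one, pow_succ _ (m + 1), mul_assoc]
  have hA0 : A 0 ≠ ⊤ := by
    have := h.lintegral_lt_top hsd0 hsd
    rw [hq] at this
    simpa [hAdef] using this.ne
  -- the `p d`-th powers of the norms of `u` in `L^{χ^{m+1} p d}`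
  set N : ℕ → ℝ≥0∞ := fun m => A m ^ (χ⁻¹ ^ (m + 1)) with hN
  set R : ℝ≥0∞ := ENNReal.ofReal (χ ^ (p * d)) with hR
  have hR1 : 1 ≤ R := by
    rw [hR, ← ENNReal.ofReal_one]
    exact ENNReal.ofReal_le_ofReal (Real.one_le_rpow hχ.le hpd.le)
  set D : ℝ≥0∞ := max 1 (C ^ (χ⁻¹) * W ^ d * R) with hD
  have hDt : D ≠ ⊤ := by
    rw [hD]
    refine (max_lt ENNReal.one_lt_top ?_).ne
    exact ENNReal.mul_lt_top (ENNReal.mul_lt_top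
      (ENNReal.rpow_lt_top_of_nonneg (by positivity) hC)
      (ENNReal.rpow_lt_top_of_nonneg hd0.le hWt)) ENNReal.ofReal_lt_top
  obtain ⟨B, hB, hNB⟩ := exists_bound_of_moser (N := N) (D := D ^ χ⁻¹) (R := R ^ χ⁻¹) hχ
    (ENNReal.one_le_rpow (le_max_left _ _) (by positivity))
    (ENNReal.one_le_rpow hR1 (by positivity)) (ENNReal.rpow_ne_top_of_nonneg (by positivity) hDt)
    (ENNReal.rpow_ne_top_of_nonneg (by positivity) ENNReal.ofReal_ne_top)
    (ENNReal.rpow_ne_top_of_nonneg (by positivity) hA0) fun m => by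
      have hχm : 0 < χ⁻¹ ^ (m + 1) := by positivity
      have e1 : ENNReal.ofReal ((χ ^ (m + 1)) ^ p) ^ d = R ^ (m + 1) := by
        rw [hR, ENNReal.ofReal_rpow_of_nonneg (by positivity) hd0.le, ← Real.rpow_mul (by positivity),
          ← ENNReal.ofReal_pow (by positivity), ← Real.rpow_natCast, ← Real.rpow_natCast,
          ← Real.rpow_mul hχ0.le, ← Real.rpow_mul hχ0.le, mul_comm]
      have e2 : (D ^ χ⁻¹ * (R ^ χ⁻¹) ^ m) ^ (χ⁻¹ ^ m) = (D * R ^ m) ^ (χ⁻¹ ^ (m + 1)) := by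
        rw [← ENNReal.rpow_natCast (R ^ χ⁻¹), ← ENNReal.rpow_mul, mul_comm χ⁻¹, ENNReal.rpow_mul R,
          ENNReal.rpow_natCast, ← ENNReal.mul_rpow_of_nonneg _ _ (by positivity),
          ← ENNReal.rpow_mul, pow_succ, mul_comm χ⁻¹]
      calc N (m + 1) = (A (m + 1) ^ χ⁻¹) ^ (χ⁻¹ ^ (m + 1)) := by
            simp only [hN]
            rw [← ENNReal.rpow_mul, pow_succ _ (m + 1), mul_comm χ⁻¹]
        _ ≤ ((C * (ENNReal.ofReal ((χ ^ (m + 1)) ^ p) * (W * A m ^ (1 / d))) ^ (χ * d)) ^ χ⁻¹) ^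
              (χ⁻¹ ^ (m + 1)) := by
            gcongr
            exact hstep m
        _ = (C ^ χ⁻¹ * (R ^ (m + 1) * (W ^ d * A m))) ^ (χ⁻¹ ^ (m + 1)) := by
            congr 1
            rw [ENNReal.mul_rpow_of_nonneg _ _ (by positivity : 0 ≤ χ⁻¹), ← ENNReal.rpow_mul _ (χ * d),
              show χ * d * χ⁻¹ = d by field_simp, ENNReal.mul_rpow_of_nonneg _ _ hd0.le, e1,
              ENNReal.mul_rpow_of_nonneg _ _ hd0.le, ← ENNReal.rpow_mul (A m), one_div_mul_cancel hd0.ne',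
              ENNReal.rpow_one]
        _ = ((C ^ χ⁻¹ * W ^ d * R) * R ^ m * A m) ^ (χ⁻¹ ^ (m + 1)) := by
            congr 1; rw [pow_succ]; ring
        _ ≤ (D * R ^ m * A m) ^ (χ⁻¹ ^ (m + 1)) := by
            gcongr
            exact le_max_right _ _
        _ = (D ^ χ⁻¹ * (R ^ χ⁻¹) ^ m) ^ (χ⁻¹ ^ m) * N m := by
            rw [e2, ENNReal.mul_rpow_of_nonneg _ _ hχm.le]
  have hbt : B ^ (1 / (p * d)) ≠ ⊤ := ENNReal.rpow_ne_top_of_nonneg (by positivity) hB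
  have hbound := ae_lt_of_lintegral_rpow_le (μ := volume.restrict Ω) h.approx.meas.enorm
    (measurable_weight k (s * d)).aemeasurable hbt (γ := fun m => χ ^ (m + 1) * (p * d)) ?_ ?_ ?_
  · have hct : 2 * B ^ (1 / (p * d)) + 1 ≠ ⊤ :=
      ENNReal.add_ne_top.2 ⟨ENNReal.mul_ne_top (by norm_num) hbt, by norm_num⟩
    refine memLp_top_of_bound h.approx.meas (2 * B ^ (1 / (p * d)) + 1).toReal
      (hbound.mono fun z hz => ?_)
    rw [← toReal_enorm]
    exact ENNReal.toReal_mono hct hz.le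
  · exact ((tendsto_pow_atTop_atTop_of_one_lt hχ).comp (tendsto_add_atTop_nat 1)).atTop_mul_const hpd
  · intro m
    have h1 : A m = N m ^ (χ ^ (m + 1)) := by
      simp only [hN]
      rw [← ENNReal.rpow_mul, ← mul_pow, inv_mul_cancel₀ hχ0.ne', one_pow, ENNReal.rpow_one]
    rw [← ENNReal.rpow_mul, show 1 / (p * d) * (χ ^ (m + 1) * (p * d)) = χ ^ (m + 1) by field_simp]
    change A m ≤ _
    rw [h1]
    exact ENNReal.rpow_le_rpow (hNB m) (by positivity)
  · have h0 : ∀ᵐ z ∂(volume : Measure (Space n)), xNorm k z ≠ 0 := by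
      rw [ae_iff]; simpa using volume_xNorm_eq_zero hk hkn
    filter_upwards [ae_restrict_of_ae h0] with z hz
    rw [weight, ne_eq, ENNReal.ofReal_eq_zero, not_le]
    exact Real.rpow_pos_of_pos ((xNorm_nonneg k z).lt_of_ne' hz) _

end IsSolution

theorem lintegral_rpow_add_one_lt_top {α : Type*} [MeasurableSpace α] {μ : Measure α} {f : α → ℝ}
    {ρ : ℝ} (hρ : 0 < ρ) (h : MemLp f (ENNReal.ofReal ρ) μ) (h' : MemLp f ⊤ μ) :
    ∫⁻ z, ‖f z‖ₑ ^ (ρ + 1) ∂μ < ⊤ := by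
  have hfin : eLpNormEssSup f μ < ⊤ := by simpa using h'.2
  refine lt_of_le_of_lt (lintegral_mono_ae (g := fun z => eLpNormEssSup f μ * ‖f z‖ₑ ^ ρ) ?_) ?_
  · filter_upwards [enorm_ae_le_eLpNormEssSup f μ] with z hz
    rw [ENNReal.rpow_add_of_nonneg _ _ hρ.le zero_le_one, ENNReal.rpow_one, mul_comm]
    gcongr
  · rw [lintegral_const_mul' _ _ hfin.ne]
    exact ENNReal.mul_lt_top hfin (lintegral_enorm_rpow_lt_top hρ h)

theorem exists_isSolution (hk : 1 < k) (hkn : k ≤ n) (hp : 1 < p) (hpn : p < n) (hs : 0 ≤ s)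
    (hsp : s < p) (hsnk : s * (n - k) < k * (n - p)) (hΩ : IsOpen Ω) (hu : MemD Ω p u)
    (hu0 : ∀ᵐ z ∂volume.restrict Ω, 0 ≤ u z) (hsub : IsWeakSubsolution k Ω p s V u)
    (hV : MemLp V (ENNReal.ofReal (rPrime n p s)) (volume.restrict Ω)) :
    ∃ g φ, IsSolution k Ω p s φ V u g := by
  obtain ⟨g, φ, hg, happ⟩ := hu.exists_isApprox hp hpn
  obtain ⟨g', hg', hweak⟩ := hsub
  have hgg := hg'.ae_eq hΩ hg
  refine ⟨g, φ,
    { one_lt := hp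
      lt_dim := hpn
      s_nonneg := hs
      s_lt := hsp
      approx := happ
      nonneg := hu0
      memLp_V := hV
      hardySobolev := fun t ht htk =>
        exists_hardySobolevBound hk hkn hp hpn ht htk hΩ.measurableSet
      dual_lt := mul_dualExp_lt hpn hs hsp hsnk
      weak := fun ψ hψ hψ0 => by
        refine (le_of_eq (integral_congr_ae (hgg.mono fun z hz => ?_))).trans (hweak ψ hψ hψ0)
        beta_reduce
        rw [hz] }⟩

end

end HardySobolev

theorem theorem2p1 (n k : ℕ) (hn : 3 ≤ n) (hk : 2 ≤ k) (hkn : k ≤ n)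
    (p s : ℝ) (hp : 1 < p) (hpn : p < n) (hs : 0 ≤ s) (hsp : s < p) (hsk : s < k)
    (hsnk : s * (n - k) < k * (n - p))
    (Ω : Set (HardySobolev.Space n)) (hΩ : IsOpen Ω)
    (V u : HardySobolev.Space n → ℝ)
    (hu : HardySobolev.MemD Ω p u)
    (hu_nonneg : ∀ᵐ z ∂(volume.restrict Ω), 0 ≤ u z)
    (hsub : HardySobolev.IsWeakSubsolution k Ω p s V u)
    (hV : MemLp V (ENNReal.ofReal (HardySobolev.rPrime n p s)) (volume.restrict Ω)) :
    ((∀ t q : ℝ, 0 ≤ t → t < min p k → HardySobolev.pStar n p t ≤ q →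
        MemLp u (ENNReal.ofReal q) (HardySobolev.weighted k Ω t)) ∧
      (∀ q : ℝ, HardySobolev.pStar n p 0 ≤ q →
        MemLp u (ENNReal.ofReal q) (volume.restrict Ω))) ∧
    (∀ t₀ : ℝ≥0∞, ENNReal.ofReal (HardySobolev.rPrime n p s) < t₀ →
      MemLp V t₀ (volume.restrict Ω) → MemLp u ∞ (volume.restrict Ω)) := by
  obtain ⟨g, φ, h⟩ := HardySobolev.exists_isSolution (by omega) hkn hp hpn hs hsp hsnk hΩ hu
    hu_nonneg hsub hV
  have hρ := HardySobolev.rPrime_pos h.pos hpn hsp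
  refine ⟨⟨fun t q ht htk hq => h.memLp_weighted ht htk hq, fun q hq => ?_⟩, fun t₀ ht₀ hVt => ?_⟩
  · have h0 : HardySobolev.weighted k Ω 0 = volume.restrict Ω := by
      simp [HardySobolev.weighted, ← Pi.one_def]
    rw [← h0]
    exact h.memLp_weighted le_rfl (lt_min h.pos (by exact_mod_cast (by omega : 0 < k))) hq
  · rcases eq_or_ne t₀ ⊤ with rfl | htop
    · exact h.memLp_top (by omega) hkn (lt_add_one _)
        (HardySobolev.lintegral_rpow_add_one_lt_top hρ hV hVt)
    · have hlt : HardySobolev.rPrime n p s < t₀.toReal :=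
        (ENNReal.ofReal_lt_iff_lt_toReal hρ.le htop).1 ht₀
      refine h.memLp_top (by omega) hkn hlt
        (HardySobolev.lintegral_enorm_rpow_lt_top (hρ.trans hlt) ?_)
      rwa [ENNReal.ofReal_toReal htop]
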